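/- **Theorem 4.2.** Let $d\ge 1$. For each $\eta>0$ let $\mathcal H_\eta$ be a real-valued functional of finite subsets of $\mathbb R^d$ such that, for every $k$, $\mathcal H_\eta(\{x_1,\dots,x_k\})$ is a Borel function of $(x_1,\dots,x_k)$. For $\nu\ge 0$ and a probability density $f$ on $\mathbb R^d$, $\mathrm{Pois}(\nu;f)$ denotes the Poisson process consisting of $N\sim\mathrm{Poisson}(\nu)$ iid points with density $f$. For $\varepsilon>0$ and an integer $m\ge 1$, divide a cube of side $\varepsilon$ into $M=m^d$ cubes $Q_1,\dots,Q_M$ of side $\varepsilon/m$, and let $u_i$ be the uniform probability density on $Q_i$; the densities $\sum_i c_iu_i$ with $c_i\ge 0$, $\sum_i c_i=1$ (for any $\varepsilon$, $m$ and any cube $x_0+\varepsilon[0,1]^d$) are called piecewise constant. Let $\mathcal D$ be a set of probability densities on $\mathbb R^d$ that contains all piecewise constant densities. Let $\mathcal H^*>0$, and assume: 1. *Translation invariance.* $\mathcal H_\eta(\mathcal X+x_0)=\mathcal H_\eta(\mathcal X)$ for all $\eta>0$, all finite $\mathcal X\subset\mathbb R^d$ and all $x_0\in\mathbb R^d$.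 2. *Linear scale.* $\lim_{\nu\to\infty}\frac1\nu\mathbb E[\mathcal H_\nu(\mathcal P^*_\nu)]=\mathcal H^*$, where $\mathcal P^*_\nu\sim\mathrm{Pois}(\nu;\mathbf 1_{[0,1]^d})$. 3. *Scale invariance.* For every $\varepsilon>0$, $\lim_{\nu\to\infty}\frac1\nu\mathbb E[\mathcal H_\nu(\mathcal P^{(\varepsilon)}_\nu)]=\mathcal H^*$, where $\mathcal P^{(\varepsilon)}_\nu\sim\mathrm{Pois}(\nu;\varepsilon^{-d}\mathbf 1_{[0,\varepsilon]^d})$. 4. *Homogeneity.* For every $g\in\mathcal D$ and $c>1$, with $\mathcal P_\nu\sim\mathrm{Pois}(\nu;g)$, $\lim_{\nu\to\infty}\mathbb E[\mathcal H_{c\nu}(\mathcal P_\nu)]/\mathbb E[\mathcal H_\nu(\mathcal P_\nu)]=1$. 5. *Additivity.* For every $\varepsilon>0$, integer $m>1$ and $c_i\ge 0$ with $\sum_ic_i=1$: if $[0,\varepsilon]^d$ is divided into $Q_1,\dots,Q_M$ as above and $\mathcal P_{\nu,i}\sim\mathrm{Pois}(c_i\nu;u_i)$ are independent, then $$\lim_{\nu\to\infty}\frac1\nu\Big|\mathbb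 E\Big[\mathcal H_\nu\Big(\bigcup_i\mathcal P_{\nu,i}\Big)\Big]-\sum_i\mathbb E[\mathcal H_\nu(\mathcal P_{\nu,i})]\Big|=0.$$ 6. *Continuity.* Let $g\in\mathcal D$ and let $g_1,g_2,\dots$ be measurable functions such that, for almost every $x$, $0\le g_1(x)\le g_2(x)\le\cdots$ and $g_i(x)\to g(x)$. Put $\delta_i=1-\int g_i$ and assume $g_i/(1-\delta_i)\in\mathcal D$ for all $i$. With $\mathcal P_\nu\sim\mathrm{Pois}(\nu;g)$ and $\mathcal P_{\nu,i}\sim\mathrm{Pois}((1-\delta_i)\nu;\,g_i/(1-\delta_i))$, $$\lim_{i\to\infty}\limsup_{\nu\to\infty}\frac1\nu\big|\mathbb E[\mathcal H_\nu(\mathcal P_\nu)]-\mathbb E[\mathcal H_\nu(\mathcal P_{\nu,i})]\big|=0.$$ Let $f\in\mathcal D$ be continuous at almost every point, let $X_1,X_2,\dots$ be iid with density $f$, and let $\mathcal X_n=\{X_1,\dots,X_n\}$ be the binomial process. Assume further: 7. *Polynomial bound.* There are $C_3,q>0$ such that for all integers $n\ge 1$, $m\ge 0$, almost surely $|\mathcal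 H_n(\mathcal X_m)|\le C_3\max(n,m)^q$. 8. *Bounded difference.* There are $a,C_4>0$, $b<1/4$ and, for every $n\ge 1$, an event $A_n$ with $\mathbb P(A_n^c)\le e^{-n^a}$ such that, almost surely, for all integers $0\le\Delta<n$, $|\mathcal H_n(\mathcal X_n)-\mathcal H_n(\mathcal X_{n\pm\Delta})|\mathbf 1_{A_n}\le C_4\,\Delta\,n^b$ (for both signs). Then $$\lim_{n\to\infty}\frac1n\mathbb E[\mathcal H_n(\mathcal X_n)]=\mathcal H^*,\qquad\text{and, almost surely,}\qquad\lim_{n\to\infty}\frac1n\mathcal H_n(\mathcal X_n)=\mathcal H^*.$$ -/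

import Mathlib

open MeasureTheory ProbabilityTheory Filter Topology

namespace ScaleInvariantFunctional

noncomputable section

/-- The space `ℝ^d` (only its topology, vector space structure and Lebesgue measure are used). -/
abbrev Point (d : ℕ) : Type := Fin d → ℝ

/-- A family `ℋ_η` of real-valued functionals of finite subsets of `ℝ^d`, with a real parameter `η`
(only `η > 0` is ever used). -/
abbrev Functional (d : ℕ) : Type := ℝ → Finset (Point d) → ℝ

variable {d : ℕ}

/-! ### Densities -/

/-- `f` is a probability density function on `ℝ^d`. -/
def IsDensity (f : Point d → ℝ) : Prop :=
  Measurable f ∧ (∀ x, 0 ≤ f x) ∧ ∫⁻ x, ENNReal.ofReal (f x) = 1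

/-- The measure `f(x) dx`. -/
def densityMeasure (f : Point d → ℝ) : Measure (Point d) :=
  volume.withDensity fun x => ENNReal.ofReal (f x)

/-- The closed cube `x₀ + s [0,1]^d`. -/
def cube (x₀ : Point d) (s : ℝ) : Set (Point d) :=
  {x | ∀ j, x j ∈ Set.Icc (x₀ j) (x₀ j + s)}

/-- The uniform density on the cube `x₀ + s [0,1]^d`. -/
def uniformDensity (x₀ : Point d) (s : ℝ) : Point d → ℝ :=
  (cube x₀ s).indicator fun _ => (s ^ d)⁻¹

/-- The uniform density on the `i`-th cell in the division of `x₀ + s [0,1]^d` into `m ^ d` cubes of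
side length `s / m`. -/
def cellDensity (x₀ : Point d) (s : ℝ) (m : ℕ) (i : Fin d → Fin m) : Point d → ℝ :=
  uniformDensity (fun j => x₀ j + s / m * ((i j : ℕ) : ℝ)) (s / m)

/-- The piecewise constant density that gives mass `c i` to the `i`-th cell. -/
def stepDensity (x₀ : Point d) (s : ℝ) (m : ℕ) (c : (Fin d → Fin m) → ℝ) : Point d → ℝ :=
  fun x => ∑ i, c i * cellDensity x₀ s m i x

/-- `𝒟` is a class of probability densities that contains all the piecewise constant densities. -/
def IsDensityClass (𝒟 : Set (Point d → ℝ)) : Prop :=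
  (∀ f ∈ 𝒟, IsDensity f) ∧
    ∀ (x₀ : Point d) (s : ℝ) (m : ℕ) (c : (Fin d → Fin m) → ℝ), 0 < s → 1 ≤ m →
      (∀ i, 0 ≤ c i) → ∑ i, c i = 1 → stepDensity x₀ s m c ∈ 𝒟

/-! ### Poisson and binomial processes -/

/-- The sample space of a finite random point configuration: the number of points, and the
points. -/
abbrev Config (d : ℕ) : Type := Σ k : ℕ, (Fin k → Point d)

/-- The finite set of points of a configuration. -/
def points (ω : Config d) : Finset (Point d) := Finset.univ.image ω.2

/-- The law of the Poisson process `Pois(ν; f)` (for `ν ≥ 0` and a density `f`): the number of points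
is Poisson with mean `ν`, and given that it equals `k`, the points are `k` iid points with
density `f`. -/
def poissonLaw (ν : ℝ) (f : Point d → ℝ) : Measure (Config d) :=
  Measure.sum fun k : ℕ =>
    poissonMeasure ν.toNNReal {k} •
      (Measure.pi fun _ : Fin k => densityMeasure f).map fun x => (⟨k, x⟩ : Config d)

/-- `𝔼[G(P)]` for `P ∼ Pois(ν; f)`. -/
def poissonMean (G : Finset (Point d) → ℝ) (ν : ℝ) (f : Point d → ℝ) : ℝ :=
  ∫ ω, G (points ω) ∂poissonLaw ν f

/-- The binomial process: the set of the first `n` points of a sequence. -/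
def binomialProcess {Ω : Type*} (X : ℕ → Ω → Point d) (n : ℕ) (ω : Ω) : Finset (Point d) :=
  (Finset.range n).image fun i => X i ω

/-! ### Conditions on the functional -/

/-- Each `ℋ_η` is a Borel function of any fixed number of points. -/
def IsMeasurable (H : Functional d) : Prop :=
  ∀ η : ℝ, 0 < η → ∀ k : ℕ, Measurable fun x : Fin k → Point d => H η (Finset.univ.image x)

def TranslationInvariant (H : Functional d) : Prop :=
  ∀ η : ℝ, 0 < η → ∀ (X : Finset (Point d)) (x₀ : Point d), H η (X.image fun x => x + x₀) = H η X

/-- `(1/ν) 𝔼[ℋ_ν(P*_ν)] → ℋ*` in the reference model, which is uniform on `[0,1]^d`. -/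
def LinearScale (H : Functional d) (Hstar : ℝ) : Prop :=
  Tendsto (fun ν : ℝ => 1 / ν * poissonMean (H ν) ν (uniformDensity 0 1)) atTop (𝓝 Hstar)

/-- The same limit for the uniform density on `ε [0,1]^d`, for every `ε > 0`. -/
def ScaleInvariant (H : Functional d) (Hstar : ℝ) : Prop :=
  ∀ ε : ℝ, 0 < ε →
    Tendsto (fun ν : ℝ => 1 / ν * poissonMean (H ν) ν (uniformDensity 0 ε)) atTop (𝓝 Hstar)

def Homogeneous (H : Functional d) (𝒟 : Set (Point d → ℝ)) : Prop :=
  ∀ f ∈ 𝒟, ∀ c : ℝ, 1 < c →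
    Tendsto (fun ν : ℝ => poissonMean (H (c * ν)) ν f / poissonMean (H ν) ν f) atTop (𝓝 1)

/-- Independent homogeneous Poisson processes `P_{ν,i} ∼ Pois(c_i ν; uniform on Q_i)` live on the cells
`Q_i` of a division of `ε [0,1]^d` into `m ^ d` cubes. Asymptotically, the mean of `ℋ_ν` on their union
is the sum of the means. -/
def AsymptoticallyAdditive (H : Functional d) : Prop :=
  ∀ (ε : ℝ) (m : ℕ) (c : (Fin d → Fin m) → ℝ), 0 < ε → 1 < m → (∀ i, 0 ≤ c i) → ∑ i, c i = 1 →
    Tendsto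
      (fun ν : ℝ => 1 / ν *
        |(∫ ω : (Fin d → Fin m) → Config d, H ν (Finset.univ.biUnion fun i => points (ω i))
              ∂(Measure.pi fun i => poissonLaw (c i * ν) (cellDensity 0 ε m i))) -
          ∑ i, poissonMean (H ν) (c i * ν) (cellDensity 0 ε m i)|)
      atTop (𝓝 0)

/-- If `g i ↑ f` almost everywhere and the normalizations `g i / ∫ g i` belong to `𝒟`, then
`lim_i limsup_ν (1/ν) |𝔼[ℋ_ν(P_ν)] - 𝔼[ℋ_ν(P_{ν,i})]| = 0`, where `P_{ν,i}` is the Poisson process with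
intensity function `ν g i`. -/
def ContinuousFromBelow (H : Functional d) (𝒟 : Set (Point d → ℝ)) : Prop :=
  ∀ f ∈ 𝒟, ∀ g : ℕ → Point d → ℝ,
    (∀ i, Measurable (g i)) →
    (∀ᵐ x, (∀ i, 0 ≤ g i x) ∧ Monotone (fun i => g i x) ∧
      Tendsto (fun i => g i x) atTop (𝓝 (f x))) →
    (∀ i, (fun x => g i x / ∫ y, g i y) ∈ 𝒟) →
    ∀ ε : ℝ, 0 < ε → ∀ᶠ i : ℕ in atTop, ∀ᶠ ν : ℝ in atTop,
      1 / ν * |poissonMean (H ν) ν f -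
        poissonMean (H ν) ((∫ y, g i y) * ν) (fun x => g i x / ∫ y, g i y)| ≤ ε

/-- `|ℋ_n(X_m)| ≤ C max(n, m)^q` almost surely. -/
def PolynomiallyBounded {Ω : Type*} [MeasurableSpace Ω] (μ : Measure Ω) (X : ℕ → Ω → Point d)
    (H : Functional d) : Prop :=
  ∃ C q : ℝ, 0 < C ∧ 0 < q ∧ ∀ n m : ℕ, 1 ≤ n →
    ∀ᵐ ω ∂μ, |H n (binomialProcess X m ω)| ≤ C * (max n m : ℝ) ^ q

/-- On an event `A n` with `μ((A n)ᶜ) ≤ exp(-n^a)`, almost surely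
`|ℋ_n(X_n) - ℋ_n(X_{n ± Δ})| ≤ C Δ n^b` for all `Δ < n`, where `b < 1/4`. -/
def BoundedDifference {Ω : Type*} [MeasurableSpace Ω] (μ : Measure Ω) (X : ℕ → Ω → Point d)
    (H : Functional d) : Prop :=
  ∃ (A : ℕ → Set Ω) (a C b : ℝ), 0 < a ∧ 0 < C ∧ b < 1 / 4 ∧ ∀ n : ℕ, 1 ≤ n →
    MeasurableSet (A n) ∧
    μ (A n)ᶜ ≤ ENNReal.ofReal (Real.exp (-(n : ℝ) ^ a)) ∧
    ∀ᵐ ω ∂μ, ω ∈ A n → ∀ Δ : ℕ, Δ < n →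
      |H n (binomialProcess X n ω) - H n (binomialProcess X (n + Δ) ω)| ≤ C * Δ * (n : ℝ) ^ b ∧
      |H n (binomialProcess X n ω) - H n (binomialProcess X (n - Δ) ω)| ≤ C * Δ * (n : ℝ) ^ b

end

end ScaleInvariantFunctional

open ScaleInvariantFunctional

namespace ScaleInvariantFunctional

open scoped ENNReal Nat

variable {d : ℕ}

/-! The limit does not depend on how the mass of the density is spread. On a cube with uniform
density the Poisson mean is asymptotic to `Hstar * ν` by scale invariance, whatever the side.
Homogeneity then gives `s * Hstar * ν` when the intensity is `s * ν` but the parameter stays `ν`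
(`Homogeneous.tendsto_thinned`). By additivity a piecewise constant density with cell masses `c i`
has limit `∑ c i * Hstar = Hstar` (`tendsto_poissonMean_stepDensity`). An almost everywhere
continuous density is the increasing limit of its dyadic lower step functions, so continuity from
below carries the limit over to it (`tendsto_poissonMean`).

Additivity speaks of independent processes on the cells, so the superposition theorem for Poisson
processes is needed (`lmarginal_poissonLaw`). Let `T_μ` be the operator on set functions that
averages over one extra point with intensity measure `μ`. The Poisson expectation is `exp(-|μ|)
exp(T_μ)`, where `|μ|` is the total mass, and these operators commute, so the exponentials multiply.

For the binomial process, a Poisson number of points with mean `n` deviates from `n` by order `n ^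
(1/2)`, and each point costs at most order `n ^ b`. The two means thus differ by `o(n)`
(`tendsto_poisson_average_sub_diagonal`). Almost sure convergence comes from applying the
Efron–Stein inequality twice (`efronStein`, `fourth_moment_le`): the fourth central moment is `O(n ^
(2 + 4 b'))` with `b' = max b 0`. Divided by `n ^ 4` this is summable because `b' < 1/4`. -/

/-! ### Set functions and the operator that adds a random point. -/

/-- Set functions that are Borel functions of any fixed number of points, with no restriction on
the target. -/
def BorelInPoints {β : Type*} [MeasurableSpace β] (Φ : Finset (Point d) → β) : Prop :=
  ∀ k : ℕ, Measurable fun x : Fin k → Point d => Φ (Finset.univ.image x)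

theorem BorelInPoints.measurable_image {β : Type*} [MeasurableSpace β] {Φ : Finset (Point d) → β}
    (hΦ : BorelInPoints Φ) {α J : Type*} [MeasurableSpace α] (s : Finset J)
    {p : J → α → Point d} (hp : ∀ j, Measurable (p j)) :
    Measurable fun a => Φ (s.image fun j => p j a) := by
  have h : ∀ a, (s.image fun j => p j a) =
      Finset.univ.image (fun i => p (s.equivFin.symm i) a) := by
    intro a
    ext y
    simp only [Finset.mem_image, Finset.mem_univ, true_and]
    constructor
    · rintro ⟨j, hj, rfl⟩
      exact ⟨s.equivFin ⟨j, hj⟩, by simp⟩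
    · rintro ⟨i, rfl⟩
      exact ⟨_, (s.equivFin.symm i).2, rfl⟩
  simp_rw [h]
  exact (hΦ s.card).comp (measurable_pi_lambda _ fun i => hp _)

theorem BorelInPoints.union_right {β : Type*} [MeasurableSpace β] {Φ : Finset (Point d) → β}
    (hΦ : BorelInPoints Φ) (S : Finset (Point d)) : BorelInPoints fun T => Φ (T ∪ S) := by
  intro k
  have h : ∀ x : Fin k → Point d, Finset.univ.image x ∪ S =
      (Finset.univ.disjSum S).image fun j => Sum.elim (fun i => x i) (fun s => s) j := by
    intro x
    ext y
    simp [Finset.mem_disjSum]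
  simp_rw [h]
  refine hΦ.measurable_image _ (p := fun j (x : Fin k → Point d) =>
    Sum.elim (fun i => x i) (fun s => s) j) ?_
  rintro (i | s)
  · exact measurable_pi_apply i
  · exact measurable_const

/-- The set function obtained by averaging over one additional point with intensity `μ`. -/
noncomputable def addPoint (μ : Measure (Point d)) (Φ : Finset (Point d) → ℝ≥0∞) :
    Finset (Point d) → ℝ≥0∞ := fun S => ∫⁻ a, Φ (insert a S) ∂μ

theorem BorelInPoints.measurable_insert {β : Type*} [MeasurableSpace β]
    {Φ : Finset (Point d) → β} (hΦ : BorelInPoints Φ) (S : Finset (Point d)) :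
    Measurable fun a => Φ (insert a S) := by
  have := (hΦ.union_right S).measurable_image (α := Point d) (J := Unit) Finset.univ
    (p := fun _ a => a) (fun _ => measurable_id)
  convert this using 3 with a
  ext y
  simp

theorem BorelInPoints.measurable_insert_insert {β : Type*} [MeasurableSpace β]
    {Φ : Finset (Point d) → β} (hΦ : BorelInPoints Φ) (S : Finset (Point d)) :
    Measurable fun a : Point d × Point d => Φ (insert a.1 (insert a.2 S)) := by
  have := (hΦ.union_right S).measurable_image (α := Point d × Point d) (J := Bool) Finset.univ
    (p := fun j a => if j then a.1 else a.2)
    (by rintro (_ | _); exacts [by simpa using measurable_snd, by simpa using measurable_fst])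
  convert this using 3 with a
  ext y
  simp

theorem BorelInPoints.addPoint {Φ : Finset (Point d) → ℝ≥0∞} (hΦ : BorelInPoints Φ)
    (μ : Measure (Point d)) [SFinite μ] : BorelInPoints (addPoint μ Φ) := by
  intro k
  have h : Measurable fun p : (Fin k → Point d) × Point d =>
      Φ (insert p.2 (Finset.univ.image p.1)) := by
    have := hΦ.measurable_image (α := (Fin k → Point d) × Point d) (J := Option (Fin k))
      Finset.univ (p := fun j p => j.elim p.2 p.1)
      (by
        rintro (_ | i)
        · exact measurable_snd
        · exact (measurable_pi_apply i).comp measurable_fst)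
    convert this using 3 with p
    ext y
    simp [Option.exists, eq_comm]
  exact h.lintegral_prod_right'

/-- Tonelli, together with the fact that a set does not remember the order of insertion. This
commutation is what lies behind superposition. -/
theorem addPoint_comm {Φ : Finset (Point d) → ℝ≥0∞} (hΦ : BorelInPoints Φ)
    (μ ν : Measure (Point d)) [SFinite μ] [SFinite ν] :
    addPoint μ (addPoint ν Φ) = addPoint ν (addPoint μ Φ) := by
  funext S
  simp only [addPoint]
  rw [lintegral_lintegral_swap]
  · simp_rw [Finset.insert_comm]
  · have := (hΦ.measurable_insert_insert S).comp measurable_swap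
    exact this.aemeasurable

/-- Integrating out one coordinate of the product is one application of `addPoint`. Coinciding
points need no care, since both sides only see the set. -/
theorem lintegral_pi_image {Φ : Finset (Point d) → ℝ≥0∞} (hΦ : BorelInPoints Φ)
    (μ : Measure (Point d)) [SigmaFinite μ] (k : ℕ) (S : Finset (Point d)) :
    ∫⁻ x : Fin k → Point d, Φ (Finset.univ.image x ∪ S) ∂Measure.pi (fun _ => μ) =
      (addPoint μ)^[k] Φ S := by
  induction k generalizing Φ with
  | zero => simp
  | succ k ih =>
    rw [Function.iterate_succ_apply, ← ih (hΦ.addPoint μ),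
      ← ((measurePreserving_piFinSuccAbove (fun _ : Fin (k + 1) => μ) 0).symm).lintegral_comp
        ((hΦ.union_right S) (k + 1)),
      lintegral_prod_symm']
    · refine lintegral_congr fun z => ?_
      simp only [addPoint]
      refine lintegral_congr fun a => ?_
      congr 1
      ext y
      simp [MeasurableEquiv.piFinSuccAbove_symm_apply, Fin.exists_fin_succ, eq_comm, or_assoc]
    · exact ((hΦ.union_right S) (k + 1)).comp (MeasurableEquiv.measurable _)

/-- The set functions to which `addPoint` applies, as an additive monoid. -/
def borelSetFunctions (d : ℕ) : AddSubmonoid (Finset (Point d) → ℝ≥0∞) where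
  carrier := {Φ | BorelInPoints Φ}
  add_mem' := fun ha hb k => (ha k).add (hb k)
  zero_mem' := fun _ => measurable_const

/-- `addPoint` as an additive endomorphism. -/
noncomputable def addPointHom (μ : Measure (Point d)) [SFinite μ] :
    AddMonoid.End (borelSetFunctions d) where
  toFun Φ := ⟨addPoint μ Φ, Φ.2.addPoint μ⟩
  map_zero' := by ext S; simp [addPoint]
  map_add' Φ Ψ := by
    ext S
    simpa [addPoint] using lintegral_add_left (Φ.2.measurable_insert S) _

theorem addPointHom_pow_apply (μ : Measure (Point d)) [SFinite μ] (k : ℕ)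
    (Φ : borelSetFunctions d) : (((addPointHom μ) ^ k) Φ).1 = (addPoint μ)^[k] Φ.1 := by
  induction k generalizing Φ with
  | zero => rfl
  | succ k ih =>
    rw [pow_succ, Function.iterate_succ_apply]
    exact ih _

/-- This is the binomial theorem for commuting elements of a semiring. `addPoint` is linear only on
Borel set functions, hence the passage to `AddMonoid.End (borelSetFunctions d)`. -/
theorem addPoint_iterate_add {Φ : Finset (Point d) → ℝ≥0∞} (hΦ : BorelInPoints Φ)
    (μ ν : Measure (Point d)) [SFinite μ] [SFinite ν] (n : ℕ) (S : Finset (Point d)) :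
    (addPoint (μ + ν))^[n] Φ S = ∑ m ∈ Finset.HasAntidiagonal.antidiagonal n,
      (n.choose m.1 : ℝ≥0∞) * (addPoint μ)^[m.1] ((addPoint ν)^[m.2] Φ) S := by
  have hc : Commute (addPointHom μ) (addPointHom (d := d) ν) := by
    ext Φ S
    exact congrFun (addPoint_comm Φ.2 μ ν) S
  have hadd : addPointHom (μ + ν) = addPointHom μ + addPointHom ν := by
    ext Φ S
    exact lintegral_add_measure _ _ _
  have h := congrArg (fun T => (T ⟨Φ, hΦ⟩).1 S) ((congrArg (· ^ n) hadd).trans (hc.add_pow' n))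
  rw [addPointHom_pow_apply] at h
  rw [h]
  have hsum : ∀ (s : Finset (ℕ × ℕ)) (T : ℕ × ℕ → AddMonoid.End (borelSetFunctions d)),
      ((∑ m ∈ s, T m) ⟨Φ, hΦ⟩).1 S = ∑ m ∈ s, (T m ⟨Φ, hΦ⟩).1 S := by
    intro s T
    induction s using Finset.induction_on with
    | empty => rfl
    | insert a s ha ih => rw [Finset.sum_insert ha, Finset.sum_insert ha, ← ih]; rfl
  rw [hsum]
  refine Finset.sum_congr rfl fun m _ => ?_
  rw [← nsmul_eq_mul, ← addPointHom_pow_apply ν m.2 ⟨Φ, hΦ⟩, ← addPointHom_pow_apply]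
  rfl

theorem BorelInPoints.addPoint_iterate {Φ : Finset (Point d) → ℝ≥0∞} (hΦ : BorelInPoints Φ)
    (μ : Measure (Point d)) [SFinite μ] (k : ℕ) :
    BorelInPoints ((ScaleInvariantFunctional.addPoint μ)^[k] Φ) := by
  rw [← addPointHom_pow_apply μ k ⟨Φ, hΦ⟩]
  exact Subtype.prop _

theorem addPoint_iterate_tsum {Φ : ℕ → Finset (Point d) → ℝ≥0∞} (hΦ : ∀ l, BorelInPoints (Φ l))
    (c : ℕ → ℝ≥0∞) (μ : Measure (Point d)) [SFinite μ] (k : ℕ) :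
    (addPoint μ)^[k] (fun S => ∑' l, c l * Φ l S) =
      fun S => ∑' l, c l * (addPoint μ)^[k] (Φ l) S := by
  induction k with
  | zero => rfl
  | succ k ih =>
    rw [Function.iterate_succ_apply', ih]
    funext S
    simp only [addPoint, Function.iterate_succ_apply']
    rw [lintegral_tsum fun l =>
      (((hΦ l).addPoint_iterate μ k).measurable_insert S).const_mul (c l) |>.aemeasurable]
    refine tsum_congr fun l => ?_
    rw [lintegral_const_mul _ (((hΦ l).addPoint_iterate μ k).measurable_insert S)]

theorem addPoint_iterate_smul (c : ℝ≥0∞) (μ : Measure (Point d)) (Φ : Finset (Point d) → ℝ≥0∞)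
    (hΦ : BorelInPoints Φ) [SFinite μ] (k : ℕ) (S : Finset (Point d)) :
    (addPoint (c • μ))^[k] Φ S = c ^ k * (addPoint μ)^[k] Φ S := by
  induction k generalizing S with
  | zero => simp
  | succ k ih =>
    rw [Function.iterate_succ_apply', Function.iterate_succ_apply']
    simp only [addPoint, ih, lintegral_smul_measure, smul_eq_mul]
    rw [lintegral_const_mul _ ((hΦ.addPoint_iterate μ k).measurable_insert S), pow_succ',
      mul_assoc]

/-- The exponential series of `addPoint μ`. -/
noncomputable def addPointExp (μ : Measure (Point d)) (Φ : Finset (Point d) → ℝ≥0∞) :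
    Finset (Point d) → ℝ≥0∞ := fun S => ∑' k : ℕ, (k ! : ℝ≥0∞)⁻¹ * (addPoint μ)^[k] Φ S

theorem BorelInPoints.addPointExp {Φ : Finset (Point d) → ℝ≥0∞} (hΦ : BorelInPoints Φ)
    (μ : Measure (Point d)) [SFinite μ] :
    BorelInPoints (ScaleInvariantFunctional.addPointExp μ Φ) :=
  fun k => Measurable.tsum fun l => ((hΦ.addPoint_iterate μ l) k).const_mul _

/-- The Cauchy product of the two exponential series. With values in `ℝ≥0∞` every rearrangement is
allowed. -/
theorem addPointExp_add {Φ : Finset (Point d) → ℝ≥0∞} (hΦ : BorelInPoints Φ)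
    (μ ν : Measure (Point d)) [SFinite μ] [SFinite ν] (S : Finset (Point d)) :
    addPointExp (μ + ν) Φ S = addPointExp μ (addPointExp ν Φ) S := by
  have hR : addPointExp μ (addPointExp ν Φ) S =
      ∑' p : ℕ × ℕ, (p.1 ! : ℝ≥0∞)⁻¹ * ((p.2 ! : ℝ≥0∞)⁻¹ *
        (addPoint μ)^[p.1] ((addPoint ν)^[p.2] Φ) S) := by
    rw [ENNReal.tsum_prod']
    refine tsum_congr fun k => ?_
    dsimp only
    rw [ENNReal.tsum_mul_left]
    congr 1
    exact congrFun (addPoint_iterate_tsum (fun l => hΦ.addPoint_iterate ν l) _ μ k) S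
  rw [hR, ← Finset.HasAntidiagonal.sigmaAntidiagonalEquivProd.tsum_eq, ENNReal.tsum_sigma']
  refine tsum_congr fun n => ?_
  rw [addPoint_iterate_add hΦ, Finset.mul_sum, tsum_fintype, ← Finset.sum_coe_sort]
  refine Finset.sum_congr rfl fun m _ => ?_
  obtain ⟨⟨k, l⟩, hm⟩ := m
  have hkl : k + l = n := by simpa using hm
  simp only [Finset.HasAntidiagonal.sigmaAntidiagonalEquivProd_apply]
  rw [← mul_assoc, ← mul_assoc]
  congr 1
  have h1 : (n.choose k : ℝ≥0∞) * (k ! * l !) = n ! := by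
    rw [← mul_assoc]
    have := Nat.choose_mul_factorial_mul_factorial (n := n) (k := k) (by omega)
    rw [show n - k = l by omega] at this
    exact_mod_cast this
  have hk : (k ! : ℝ≥0∞) ≠ 0 := by exact_mod_cast k.factorial_ne_zero
  have hl : (l ! : ℝ≥0∞) ≠ 0 := by exact_mod_cast l.factorial_ne_zero
  have hn : (n ! : ℝ≥0∞) ≠ 0 := by exact_mod_cast n.factorial_ne_zero
  rw [← ENNReal.mul_inv (Or.inl hk) (Or.inl (by simp))]
  refine ENNReal.eq_inv_of_mul_eq_one_left ?_
  rw [mul_assoc, h1]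
  exact ENNReal.inv_mul_cancel hn (by simp)

/-! ### Random configurations and superposition of Poisson processes. -/

theorem measurable_config {β : Type*} [MeasurableSpace β] {F : Config d → β}
    (h : ∀ k, Measurable fun x : Fin k → Point d => F ⟨k, x⟩) : Measurable F := fun _ hs =>
  MeasurableSpace.measurableSet_iInf.2 fun k => h k hs

theorem measurable_configMk (k : ℕ) :
    Measurable fun x : Fin k → Point d => (⟨k, x⟩ : Config d) := fun _ hs =>
  MeasurableSpace.measurableSet_iInf.1 hs k

/-- A configuration as a number of points and an infinite sequence starting with these points. -/
noncomputable def encodeConfig (ω : Config d) : ℕ × (ℕ → Point d) :=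
  (ω.1, fun i => if h : i < ω.1 then ω.2 ⟨i, h⟩ else 0)

theorem measurable_encodeConfig : Measurable (encodeConfig (d := d)) := by
  refine measurable_config fun k => measurable_const.prodMk (measurable_pi_lambda _ fun i => ?_)
  by_cases h : i < k
  · simpa [h] using measurable_pi_apply (⟨i, h⟩ : Fin k)
  · simp [h]

theorem image_encodeConfig (ω : Config d) :
    (Finset.range (encodeConfig ω).1).image (encodeConfig ω).2 = points ω := by
  ext y
  simp only [encodeConfig, points, Finset.mem_image, Finset.mem_range, Finset.mem_univ, true_and]
  constructor
  · rintro ⟨i, hi, rfl⟩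
    exact ⟨⟨i, hi⟩, by simp [hi]⟩
  · rintro ⟨i, rfl⟩
    exact ⟨i, i.2, by simp⟩

/-- `encodeConfig` moves configurations of varying size into one fixed space. There are countably
many vectors of counts, and for each of them the union is the image of a fixed finite index set. -/
theorem BorelInPoints.measurable_biUnion {β : Type*} [MeasurableSpace β]
    {Φ : Finset (Point d) → β} (hΦ : BorelInPoints Φ) {ι : Type*} [Fintype ι] (s : Finset ι) :
    Measurable fun ω : ι → Config d => Φ (s.biUnion fun i => points (ω i)) := by
  have h : Measurable fun p : (ι → ℕ) × (ι → ℕ → Point d) =>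
      Φ (s.biUnion fun i => (Finset.range (p.1 i)).image (p.2 i)) := by
    refine measurable_from_prod_countable_right fun k => ?_
    have h := hΦ.measurable_image (α := ι → ℕ → Point d) (s.sigma fun i => Finset.range (k i))
      (p := fun j x => x j.1 j.2)
      (fun j => (measurable_pi_apply j.2).comp (measurable_pi_apply j.1))
    convert h using 3 with x
    ext y
    simp [and_assoc]
  have h2 : Measurable fun ω : ι → Config d =>
      ((fun i => (encodeConfig (ω i)).1, fun i => (encodeConfig (ω i)).2) :
        (ι → ℕ) × (ι → ℕ → Point d)) :=
    (measurable_pi_lambda _ fun i =>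
        (measurable_fst.comp measurable_encodeConfig).comp (measurable_pi_apply i)).prodMk
      (measurable_pi_lambda _ fun i =>
        (measurable_snd.comp measurable_encodeConfig).comp (measurable_pi_apply i))
  have h3 := h.comp h2
  simpa only [Function.comp_def, image_encodeConfig] using h3

theorem BorelInPoints.measurable_points {β : Type*} [MeasurableSpace β]
    {Φ : Finset (Point d) → β} (hΦ : BorelInPoints Φ) :
    Measurable fun ω : Config d => Φ (points ω) := measurable_config hΦ

theorem IsDensity.isProbabilityMeasure {f : Point d → ℝ} (hf : IsDensity f) :
    IsProbabilityMeasure (densityMeasure f) :=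
  ⟨by simpa [densityMeasure, withDensity_apply] using hf.2.2⟩

theorem lintegral_poissonLaw_sum (ν : ℝ) (f : Point d → ℝ) {F : Config d → ℝ≥0∞}
    (hF : Measurable F) : ∫⁻ ω, F ω ∂poissonLaw ν f = ∑' k : ℕ, poissonMeasure ν.toNNReal {k} *
      ∫⁻ x : Fin k → Point d, F ⟨k, x⟩ ∂Measure.pi fun _ => densityMeasure f := by
  rw [poissonLaw, lintegral_sum_measure]
  refine tsum_congr fun k => ?_
  rw [lintegral_smul_measure, lintegral_map hF (measurable_configMk k), smul_eq_mul]

theorem isProbabilityMeasure_poissonLaw (ν : ℝ) {f : Point d → ℝ} (hf : IsDensity f) :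
    IsProbabilityMeasure (poissonLaw ν f) := by
  have := hf.isProbabilityMeasure
  refine ⟨?_⟩
  rw [← lintegral_one, lintegral_poissonLaw_sum ν f measurable_const]
  simp only [lintegral_one, measure_univ, mul_one]
  have h := lintegral_countable' (μ := poissonMeasure ν.toNNReal) (fun _ => 1)
  simpa using h.symm

/-- The factor `ν ^ k / k!` of the Poisson weight is absorbed into the exponential series of the
intensity measure, so only `exp(-ν)` remains outside. -/
theorem lintegral_poissonLaw {ν : ℝ} (hν : 0 ≤ ν) {f : Point d → ℝ} (hf : IsDensity f)
    {Φ : Finset (Point d) → ℝ≥0∞} (hΦ : BorelInPoints Φ) (S : Finset (Point d)) :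
    ∫⁻ ω, Φ (points ω ∪ S) ∂poissonLaw ν f = ENNReal.ofReal (Real.exp (-ν)) *
      addPointExp (ENNReal.ofReal ν • densityMeasure f) Φ S := by
  have := hf.isProbabilityMeasure
  rw [lintegral_poissonLaw_sum ν f (hΦ.union_right S).measurable_points, addPointExp,
    ← ENNReal.tsum_mul_left]
  refine tsum_congr fun k => ?_
  rw [addPoint_iterate_smul _ _ _ hΦ, ← lintegral_pi_image hΦ, poissonMeasure_singleton,
    Real.coe_toNNReal _ hν, ← mul_assoc, ← mul_assoc]
  congr 1
  rw [ENNReal.ofReal_div_of_pos (by positivity), ENNReal.ofReal_mul (by positivity),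
    ENNReal.ofReal_pow hν, ENNReal.ofReal_natCast, ENNReal.div_eq_inv_mul]
  ring

theorem addPointExp_zero (Φ : Finset (Point d) → ℝ≥0∞) (S : Finset (Point d)) :
    addPointExp 0 Φ S = Φ S := by
  have h0 : ∀ k, (addPoint (0 : Measure (Point d)))^[k + 1] Φ S = 0 := by
    intro k
    rw [Function.iterate_succ_apply']
    simp [addPoint]
  rw [addPointExp, tsum_eq_zero_add' ENNReal.summable]
  simp [h0]

/-- Superposition: the union of independent Poisson processes is a Poisson process. -/
theorem lmarginal_poissonLaw {ι : Type*} [Fintype ι] [DecidableEq ι] {ν : ι → ℝ}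
    (hν : ∀ i, 0 ≤ ν i) {f : ι → Point d → ℝ} (hf : ∀ i, IsDensity (f i)) (s : Finset ι)
    {Φ : Finset (Point d) → ℝ≥0∞} (hΦ : BorelInPoints Φ) :
    ∫⋯∫⁻_s, (fun ω : ι → Config d => Φ (s.biUnion fun i => points (ω i)))
        ∂(fun i => poissonLaw (ν i) (f i)) =
      fun _ => ENNReal.ofReal (Real.exp (-∑ i ∈ s, ν i)) *
        addPointExp (∑ i ∈ s, ENNReal.ofReal (ν i) • densityMeasure (f i)) Φ ∅ := by
  have := fun i => (hf i).isProbabilityMeasure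
  have := fun i => isProbabilityMeasure_poissonLaw (ν i) (hf i)
  induction s using Finset.induction_on generalizing Φ with
  | empty =>
    funext ω
    simp [addPointExp_zero]
  | insert i s hi ih =>
    rw [lmarginal_insert' _ (hΦ.measurable_biUnion _) hi]
    have h1 : (fun ω : ι → Config d => ∫⁻ c, Φ ((insert i s).biUnion fun j =>
        points (Function.update ω i c j)) ∂poissonLaw (ν i) (f i)) = fun ω =>
        (fun S => ENNReal.ofReal (Real.exp (-ν i)) *
          addPointExp (ENNReal.ofReal (ν i) • densityMeasure (f i)) Φ S)
          (s.biUnion fun j => points (ω j)) := by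
      funext ω
      dsimp only
      rw [← lintegral_poissonLaw (hν i) (hf i) hΦ]
      refine lintegral_congr fun c => ?_
      rw [Finset.biUnion_insert, Function.update_self]
      congr 2
      refine Finset.biUnion_congr rfl fun j hj => ?_
      rw [Function.update_of_ne (ne_of_mem_of_not_mem hj hi)]
    rw [h1, ih (Φ := fun S => ENNReal.ofReal (Real.exp (-ν i)) *
      addPointExp (ENNReal.ofReal (ν i) • densityMeasure (f i)) Φ S)
      fun k => ((hΦ.addPointExp _) k).const_mul _]
    funext ω
    -- A constant multiple is the series whose only nonzero coefficient is the one at `l = 0`, so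
    -- `addPoint_iterate_tsum` covers it.
    have h2 : ∀ (c : ℝ≥0∞) (μ : Measure (Point d)) [SFinite μ] (Ψ : Finset (Point d) → ℝ≥0∞),
        BorelInPoints Ψ → addPointExp μ (fun S => c * Ψ S) ∅ = c * addPointExp μ Ψ ∅ := by
      intro c μ _ Ψ hΨ
      simp only [addPointExp]
      rw [← ENNReal.tsum_mul_left]
      refine tsum_congr fun k => ?_
      have := congrFun (addPoint_iterate_tsum (Φ := fun _ => Ψ) (fun _ => hΨ)
        (fun l => if l = 0 then c else 0) μ k) ∅
      simp only [ite_mul, zero_mul, tsum_ite_eq] at this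
      rw [this]
      ring
    have h3 : SFinite (∑ i ∈ s, ENNReal.ofReal (ν i) • densityMeasure (f i)) := by
      rw [← Measure.sum_coe_finset]
      infer_instance
    rw [h2 _ _ _ (hΦ.addPointExp _), ← addPointExp_add hΦ, Finset.sum_insert hi,
      Finset.sum_insert hi, ← mul_assoc, ← ENNReal.ofReal_mul (by positivity), ← Real.exp_add]
    rw [add_comm (∑ i ∈ s, ENNReal.ofReal (ν i) • densityMeasure (f i))]
    congr 3
    ring

/-- If two random finite sets have the same law on set functions, then integrals of real set
functions agree. -/
theorem integral_eq_of_lintegral_eq {α β : Type*} [MeasurableSpace α] [MeasurableSpace β]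
    {P : Measure α} {Q : Measure β} {p : α → Finset (Point d)} {q : β → Finset (Point d)}
    (hp : ∀ Φ : Finset (Point d) → ℝ, BorelInPoints Φ → Measurable fun a => Φ (p a))
    (hq : ∀ Φ : Finset (Point d) → ℝ, BorelInPoints Φ → Measurable fun b => Φ (q b))
    (h : ∀ Φ : Finset (Point d) → ℝ≥0∞, BorelInPoints Φ →
      ∫⁻ a, Φ (p a) ∂P = ∫⁻ b, Φ (q b) ∂Q)
    {G : Finset (Point d) → ℝ} (hG : BorelInPoints G) :
    ∫ a, G (p a) ∂P = ∫ b, G (q b) ∂Q := by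
  -- Testing with indicators of events `G ∈ s` identifies the two laws on `ℝ`. The Bochner integrals
  -- then agree whether or not they converge.
  have hmap : P.map (fun a => G (p a)) = Q.map (fun b => G (q b)) := by
    ext s hs
    have h1 := h (fun S => s.indicator (fun _ => 1) (G S))
      (fun k => (measurable_const.indicator hs).comp (hG k))
    rw [Measure.map_apply (hp G hG) hs, Measure.map_apply (hq G hG) hs,
      ← lintegral_indicator_one (hp G hG hs), ← lintegral_indicator_one (hq G hG hs)]
    exact h1
  have h1 := integral_map (μ := P) (hp G hG).aemeasurable (f := fun x : ℝ => x)
    measurable_id.aestronglyMeasurable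
  have h2 := integral_map (μ := Q) (hq G hG).aemeasurable (f := fun x : ℝ => x)
    measurable_id.aestronglyMeasurable
  rw [← h1, ← h2, hmap]

/-- The mean of a functional of a superposition of independent Poisson processes. -/
theorem integral_biUnion_poissonLaw {ι : Type*} [Fintype ι] [DecidableEq ι] {ν : ℝ} (hν : 0 ≤ ν)
    {c : ι → ℝ} (hc : ∀ i, 0 ≤ c i) (hc1 : ∑ i, c i = 1) {f : ι → Point d → ℝ}
    (hf : ∀ i, IsDensity (f i)) {g : Point d → ℝ} (hg : IsDensity g)
    (hgf : ∀ x, g x = ∑ i, c i * f i x) {G : Finset (Point d) → ℝ} (hG : BorelInPoints G) :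
    ∫ ω : ι → Config d, G (Finset.univ.biUnion fun i => points (ω i))
      ∂(Measure.pi fun i => poissonLaw (c i * ν) (f i)) = poissonMean G ν g := by
  have := fun i => isProbabilityMeasure_poissonLaw (c i * ν) (hf i)
  refine integral_eq_of_lintegral_eq (fun Φ hΦ => hΦ.measurable_biUnion _)
    (fun Φ hΦ => hΦ.measurable_points) (fun Φ hΦ => ?_) hG
  have h1 := lintegral_poissonLaw hν hg hΦ ∅
  simp only [Finset.union_empty] at h1
  rw [lintegral_eq_lmarginal_univ (fun _ => ⟨0, fun _ => 0⟩),
    lmarginal_poissonLaw (fun i => mul_nonneg (hc i) hν) hf _ hΦ, h1, ← Finset.sum_mul, hc1,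
    one_mul]
  have h2 : densityMeasure g = ∑ i, ENNReal.ofReal (c i) • densityMeasure (f i) := by
    ext s hs
    simp only [densityMeasure, Measure.coe_finsetSum, Finset.sum_apply, Measure.smul_apply,
      withDensity_apply _ hs, smul_eq_mul]
    simp_rw [hgf]
    rw [lintegral_congr fun x => ENNReal.ofReal_sum_of_nonneg fun i _ =>
      mul_nonneg (hc i) ((hf i).2.1 x), lintegral_finsetSum _ fun i _ =>
        ((hf i).1.const_mul _).ennreal_ofReal]
    refine Finset.sum_congr rfl fun i _ => ?_
    simp_rw [ENNReal.ofReal_mul (hc i)]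
    rw [lintegral_const_mul _ (hf i).1.ennreal_ofReal]
  have h3 : ∑ i, ENNReal.ofReal (c i * ν) • densityMeasure (f i) =
      ENNReal.ofReal ν • densityMeasure g := by
    rw [h2, Finset.smul_sum]
    refine Finset.sum_congr rfl fun i _ => ?_
    rw [smul_smul, mul_comm (c i), ENNReal.ofReal_mul hν]
  rw [h3]

/-! ### Translation, empty processes and uniform densities. -/

theorem densityMeasure_translate {f : Point d → ℝ} (x₀ : Point d) :
    densityMeasure (fun x => f (x - x₀)) = (densityMeasure f).map (· + x₀) := by
  ext s hs
  have hs' : MeasurableSet ((· + x₀) ⁻¹' s) := measurable_add_const x₀ hs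
  rw [Measure.map_apply (measurable_add_const x₀) hs, densityMeasure, densityMeasure,
    withDensity_apply _ hs, withDensity_apply _ hs', ← lintegral_indicator hs,
    ← lintegral_indicator hs', ← lintegral_sub_right_eq_self (((· + x₀) ⁻¹' s).indicator _) x₀]
  refine lintegral_congr fun x => ?_
  have h : x - x₀ ∈ (· + x₀) ⁻¹' s ↔ x ∈ s := by rw [Set.mem_preimage, sub_add_cancel]
  by_cases hx : x ∈ s
  · rw [Set.indicator_of_mem hx, Set.indicator_of_mem (h.2 hx)]
  · rw [Set.indicator_of_notMem hx, Set.indicator_of_notMem (mt h.1 hx)]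

/-- The shifted density generates the shifted process, and `G` does not see the shift. -/
theorem poissonMean_translate {G : Finset (Point d) → ℝ} (hG : BorelInPoints G)
    (htrans : ∀ (X : Finset (Point d)) (x₀ : Point d), G (X.image fun x => x + x₀) = G X)
    (ν : ℝ) {f : Point d → ℝ} (hf : IsDensity f) (x₀ : Point d) :
    poissonMean G ν (fun x => f (x - x₀)) = poissonMean G ν f := by
  have := hf.isProbabilityMeasure
  have hpoints : ∀ (k : ℕ) (x : Fin k → Point d),
      (points (⟨k, x⟩ : Config d)).image (· + x₀) = Finset.univ.image fun i => x i + x₀ := by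
    intro k x
    rw [points, Finset.image_image]
    rfl
  have hshift : ∀ k, Measurable fun (x : Fin k → Point d) (i : Fin k) => x i + x₀ := fun k =>
    measurable_pi_lambda _ fun i => (measurable_add_const x₀).comp (measurable_pi_apply i)
  have hq : ∀ {β : Type} [MeasurableSpace β] (Φ : Finset (Point d) → β), BorelInPoints Φ →
      Measurable fun ω : Config d => Φ ((points ω).image (· + x₀)) := by
    intro β _ Φ hΦ
    refine measurable_config fun k => ?_
    simp_rw [hpoints]
    exact (hΦ k).comp (hshift k)
  have h := integral_eq_of_lintegral_eq (P := poissonLaw ν fun x => f (x - x₀))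
    (Q := poissonLaw ν f) (p := points) (q := fun ω => (points ω).image (· + x₀))
    (fun Φ hΦ => hΦ.measurable_points) (fun Φ hΦ => hq Φ hΦ) (fun Φ hΦ => ?_) hG
  · rw [poissonMean, h]
    simp_rw [htrans]
    rfl
  · rw [lintegral_poissonLaw_sum _ _ hΦ.measurable_points, lintegral_poissonLaw_sum _ _ (hq Φ hΦ)]
    refine tsum_congr fun k => ?_
    congr 1
    simp_rw [hpoints, densityMeasure_translate x₀]
    rw [← Measure.pi_map_pi fun _ => (measurable_add_const x₀).aemeasurable]
    exact lintegral_map (hΦ k) (hshift k)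

/-- Needed for cells of mass zero, whose process is empty. -/
theorem poissonMean_zero {G : Finset (Point d) → ℝ} (hG : BorelInPoints G) {f : Point d → ℝ}
    (hf : IsDensity f) : poissonMean G 0 f = G ∅ := by
  have h := integral_eq_of_lintegral_eq (P := poissonLaw 0 f)
    (Q := Measure.dirac ()) (p := points) (q := fun _ => ∅)
    (fun Φ hΦ => hΦ.measurable_points) (fun Φ hΦ => measurable_const) (fun Φ hΦ => ?_) hG
  · rw [poissonMean, h]
    simp
  · have h := lintegral_poissonLaw le_rfl hf hΦ ∅
    simp only [Finset.union_empty] at h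
    rw [h]
    simp [addPointExp_zero]

theorem volume_cube (x₀ : Point d) {s : ℝ} (hs : 0 ≤ s) :
    volume (cube x₀ s) = ENNReal.ofReal (s ^ d) := by
  have h : cube x₀ s = Set.Icc x₀ (fun j => x₀ j + s) := by
    ext x
    simp [cube, Set.mem_Icc, Pi.le_def, forall_and]
  rw [h, Real.volume_Icc_pi]
  simp [ENNReal.ofReal_pow hs]

theorem measurableSet_cube (x₀ : Point d) (s : ℝ) : MeasurableSet (cube x₀ s) := by
  have h : cube x₀ s = Set.Icc x₀ (fun j => x₀ j + s) := by
    ext x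
    simp [cube, Set.mem_Icc, Pi.le_def, forall_and]
  rw [h]
  exact measurableSet_Icc

theorem isDensity_uniformDensity (x₀ : Point d) {s : ℝ} (hs : 0 < s) :
    IsDensity (uniformDensity x₀ s) := by
  refine ⟨measurable_const.indicator (measurableSet_cube x₀ s),
    fun x => Set.indicator_nonneg (fun _ _ => by positivity) x, ?_⟩
  have h : ∀ x, ENNReal.ofReal (uniformDensity x₀ s x) =
      (cube x₀ s).indicator (fun _ => ENNReal.ofReal (s ^ d)⁻¹) x := by
    intro x
    by_cases hx : x ∈ cube x₀ s <;> simp [uniformDensity, hx]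
  rw [lintegral_congr h, lintegral_indicator (measurableSet_cube x₀ s), lintegral_const,
    Measure.restrict_apply_univ, volume_cube x₀ hs.le, ← ENNReal.ofReal_mul (by positivity),
    inv_mul_cancel₀ (by positivity), ENNReal.ofReal_one]

theorem isDensity_cellDensity (x₀ : Point d) {s : ℝ} (hs : 0 < s) {m : ℕ} (hm : 1 ≤ m)
    (i : Fin d → Fin m) : IsDensity (cellDensity x₀ s m i) :=
  isDensity_uniformDensity _ (div_pos hs (by exact_mod_cast hm))

theorem uniformDensity_eq_translate (x₀ : Point d) (s : ℝ) :
    uniformDensity x₀ s = fun x => uniformDensity 0 s (x - x₀) := by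
  funext x
  simp only [uniformDensity, Set.indicator, cube, Set.mem_ofPred_eq, Set.mem_Icc]
  congr 1
  refine propext (forall_congr' fun j => ?_)
  simp only [Pi.zero_apply, Pi.sub_apply, zero_add, sub_nonneg, sub_le_iff_le_add]
  rw [add_comm s]

theorem stepDensity_eq_translate (x₀ : Point d) (s : ℝ) (m : ℕ) (c : (Fin d → Fin m) → ℝ) :
    stepDensity x₀ s m c = fun x => stepDensity 0 s m c (x - x₀) := by
  funext x
  refine Finset.sum_congr rfl fun i _ => ?_
  rw [cellDensity, cellDensity, uniformDensity_eq_translate, uniformDensity_eq_translate (fun j =>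
    (0 : Point d) j + s / m * ((i j : ℕ) : ℝ))]
  dsimp only
  congr 2
  ext j
  simp only [Pi.sub_apply, Pi.zero_apply]
  ring

theorem IsDensityClass.uniformDensity_mem {𝒟 : Set (Point d → ℝ)} (h𝒟 : IsDensityClass 𝒟)
    (x₀ : Point d) {s : ℝ} (hs : 0 < s) : uniformDensity x₀ s ∈ 𝒟 := by
  have h := h𝒟.2 x₀ s 1 (fun _ => 1) hs le_rfl (fun _ => zero_le_one) (by simp)
  convert h using 1
  funext x
  simp [stepDensity, cellDensity]

/-! ### The Poisson limit for piecewise constant densities. -/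

/-- By homogeneity, the limit of the mean at intensity `s ν` for `s ∈ (0, 1]`. -/
theorem Homogeneous.tendsto_thinned {H : Functional d} {𝒟 : Set (Point d → ℝ)}
    (hhom : Homogeneous H 𝒟) {Hstar : ℝ} (hpos : 0 < Hstar) {h : Point d → ℝ} (hh : h ∈ 𝒟)
    (hlim : Tendsto (fun ν : ℝ => 1 / ν * poissonMean (H ν) ν h) atTop (𝓝 Hstar))
    {s : ℝ} (hs : 0 < s) (hs1 : s ≤ 1) :
    Tendsto (fun ν : ℝ => 1 / ν * poissonMean (H ν) (s * ν) h) atTop (𝓝 (s * Hstar)) := by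
  rcases hs1.eq_or_lt with rfl | hs1
  · simpa using hlim
  -- Homogeneity with factor `s⁻¹` gives the limit for parameter `s⁻¹ * ν` and intensity `ν`.
  -- Replacing `ν` by `s * ν` gives the claim.
  have h1 := (hhom h hh s⁻¹ (one_lt_inv_iff₀.2 ⟨hs, hs1⟩)).mul hlim
  rw [one_mul] at h1
  have h2 : Tendsto (fun ν : ℝ => 1 / ν * poissonMean (H (s⁻¹ * ν)) ν h) atTop (𝓝 Hstar) := by
    refine h1.congr' ?_
    -- Since `Hstar > 0`, the denominator in the homogeneity quotient is eventually nonzero and can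
    -- be cancelled.
    filter_upwards [hlim.eventually_ne hpos.ne'] with ν hν
    have hne : poissonMean (H ν) ν h ≠ 0 := fun h0 => hν (by rw [h0, mul_zero])
    field_simp
  have h3 := (h2.comp (tendsto_id.const_mul_atTop hs)).const_mul s
  refine h3.congr' ?_
  filter_upwards with ν
  simp only [Function.comp_apply, id]
  rw [inv_mul_cancel_left₀ hs.ne']
  field_simp

section Step

variable {H : Functional d} {𝒟 : Set (Point d → ℝ)} {Hstar : ℝ}

theorem integral_cells_eq (hmeas : IsMeasurable H) (h𝒟 : IsDensityClass 𝒟) {ε : ℝ} (hε : 0 < ε)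
    {m : ℕ} (hm : 1 < m) {c : (Fin d → Fin m) → ℝ} (hc : ∀ i, 0 ≤ c i) (hc1 : ∑ i, c i = 1)
    {ν : ℝ} (hν : 0 < ν) :
    (∫ ω : (Fin d → Fin m) → Config d, H ν (Finset.univ.biUnion fun i => points (ω i))
      ∂(Measure.pi fun i => poissonLaw (c i * ν) (cellDensity 0 ε m i))) =
      poissonMean (H ν) ν (stepDensity 0 ε m c) :=
  integral_biUnion_poissonLaw hν.le hc hc1 (fun i => isDensity_cellDensity 0 hε hm.le i)
    (h𝒟.1 _ (h𝒟.2 0 ε m c hε hm.le hc hc1)) (fun _ => rfl) (hmeas ν hν)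

/-- Additivity forces the value at the empty set to be negligible. -/
theorem tendsto_empty (hd : 1 ≤ d) (hmeas : IsMeasurable H) (h𝒟 : IsDensityClass 𝒟)
    (hadd : AsymptoticallyAdditive H) : Tendsto (fun ν : ℝ => 1 / ν * H ν ∅) atTop (𝓝 0) := by
  -- All mass is put in one of the `2 ^ d` cells. The union is then the process of that cell, and
  -- the defect in additivity is exactly `(2 ^ d - 1) * H ν ∅`, with `2 ^ d - 1 ≥ 1` because `d ≥
  -- 1`.
  set i₀ : Fin d → Fin 2 := fun _ => 0
  set c : (Fin d → Fin 2) → ℝ := Pi.single i₀ 1 with hcdef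
  have hc : ∀ i, 0 ≤ c i := fun i => by
    rw [hcdef, Pi.single_apply]
    split_ifs <;> norm_num
  have hc1 : ∑ i, c i = 1 := by simp [hcdef]
  have h := hadd 1 2 c one_pos one_lt_two hc hc1
  refine squeeze_zero_norm' ?_ h
  filter_upwards [eventually_gt_atTop 0] with ν hν
  rw [integral_cells_eq hmeas h𝒟 one_pos one_lt_two hc hc1 hν]
  have h1 : stepDensity 0 1 2 c = cellDensity 0 1 2 i₀ := by
    funext x
    simp [stepDensity, hcdef, Pi.single_apply]
  have h2 : ∑ i, poissonMean (H ν) (c i * ν) (cellDensity 0 1 2 i) =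
      poissonMean (H ν) ν (cellDensity 0 1 2 i₀) + ((2 : ℝ) ^ d - 1) * H ν ∅ := by
    rw [← Finset.add_sum_erase _ _ (Finset.mem_univ i₀)]
    congr 1
    · simp [hcdef]
    · rw [Finset.sum_congr rfl (g := fun _ => H ν ∅)]
      · rw [Finset.sum_const, Finset.card_erase_of_mem (Finset.mem_univ _), nsmul_eq_mul,
          Nat.cast_sub (Finset.card_pos.2 ⟨i₀, Finset.mem_univ _⟩)]
        simp
      · intro i hi
        have : c i = 0 := by simp [hcdef, Finset.ne_of_mem_erase hi]
        rw [this, zero_mul, poissonMean_zero (hmeas ν hν) (isDensity_cellDensity 0 one_pos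
          one_le_two i)]
  rw [h1, h2, sub_add_cancel_left, abs_neg, abs_mul, norm_mul, Real.norm_eq_abs, Real.norm_eq_abs,
    abs_of_pos (by positivity : 0 < 1 / ν)]
  have h3 : (2 : ℝ) ≤ 2 ^ d := by
    calc (2 : ℝ) = 2 ^ 1 := by norm_num
      _ ≤ 2 ^ d := pow_le_pow_right₀ one_le_two hd
  refine mul_le_mul_of_nonneg_left ?_ (by positivity)
  rw [abs_of_pos (by linarith : (0 : ℝ) < 2 ^ d - 1)]
  nlinarith [abs_nonneg (H ν ∅)]

/-- Each cell is a translate of a cube at the origin and contributes `c i * Hstar`. The masses add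
up to one, so their distribution over the cells disappears. -/
theorem tendsto_poissonMean_stepDensity (hd : 1 ≤ d) (hmeas : IsMeasurable H)
    (h𝒟 : IsDensityClass 𝒟) (hpos : 0 < Hstar) (htrans : TranslationInvariant H)
    (hscale : ScaleInvariant H Hstar) (hhom : Homogeneous H 𝒟) (hadd : AsymptoticallyAdditive H)
    (x₀ : Point d) {s : ℝ} (hs : 0 < s) {m : ℕ} (hm : 1 < m) {c : (Fin d → Fin m) → ℝ}
    (hc : ∀ i, 0 ≤ c i) (hc1 : ∑ i, c i = 1) :
    Tendsto (fun ν : ℝ => 1 / ν * poissonMean (H ν) ν (stepDensity x₀ s m c)) atTop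
      (𝓝 Hstar) := by
  have hsm : 0 < s / m := div_pos hs (by exact_mod_cast hm.le)
  have hcell : ∀ i, Tendsto (fun ν : ℝ => 1 / ν *
      poissonMean (H ν) (c i * ν) (cellDensity 0 s m i)) atTop (𝓝 (c i * Hstar)) := by
    intro i
    rcases (hc i).eq_or_lt with h0 | h0
    -- Homogeneity says nothing about intensity zero, so an empty cell relies on `tendsto_empty`.
    · rw [← h0, zero_mul]
      refine (tendsto_empty hd hmeas h𝒟 hadd).congr' ?_
      filter_upwards [eventually_gt_atTop 0] with ν hν
      rw [zero_mul, poissonMean_zero (hmeas ν hν) (isDensity_cellDensity 0 hs hm.le i)]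
    · refine (hhom.tendsto_thinned hpos (h𝒟.uniformDensity_mem 0 hsm) (hscale _ hsm) h0
        (hc1 ▸ Finset.single_le_sum (fun j _ => hc j) (Finset.mem_univ i))).congr' ?_
      filter_upwards [eventually_gt_atTop 0] with ν hν
      rw [cellDensity, uniformDensity_eq_translate (fun j => (0 : Point d) j + _),
        poissonMean_translate (hmeas ν hν) (htrans ν hν) _ (isDensity_uniformDensity 0 hsm)]
  have hsum := tendsto_finsetSum Finset.univ fun i _ => hcell i
  rw [← Finset.sum_mul, hc1, one_mul] at hsum
  have hdiff : Tendsto (fun ν : ℝ => 1 / ν * poissonMean (H ν) ν (stepDensity x₀ s m c) -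
      ∑ i, 1 / ν * poissonMean (H ν) (c i * ν) (cellDensity 0 s m i)) atTop (𝓝 0) := by
    refine squeeze_zero_norm' ?_ (hadd s m c hs hm hc hc1)
    filter_upwards [eventually_gt_atTop 0] with ν hν
    rw [integral_cells_eq hmeas h𝒟 hs hm hc hc1 hν, stepDensity_eq_translate x₀,
      poissonMean_translate (hmeas ν hν) (htrans ν hν) _ (h𝒟.1 _ (h𝒟.2 0 s m c hs hm.le hc hc1)),
      ← Finset.mul_sum, ← mul_sub, norm_mul, Real.norm_eq_abs, Real.norm_eq_abs,
      abs_of_pos (by positivity : 0 < 1 / ν)]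
  simpa using hdiff.add hsum

end Step

/-! ### Dyadic lower step functions. -/

/-- The lower left corner of the dyadic cube of side `2⁻ᴺ` that contains `x`. -/
noncomputable def dyadicCorner (N : ℕ) (x : Point d) : Point d :=
  fun j => (⌊x j * 2 ^ N⌋ : ℝ) / 2 ^ N

/-- The dyadic cube of side `2⁻ᴺ` that contains `x`. -/
noncomputable def dyadicCube (N : ℕ) (x : Point d) : Set (Point d) :=
  cube (dyadicCorner N x) (2 ^ N)⁻¹

/-- The lower left corner of the `i`-th dyadic cell in the box `[-2ᴺ, 2ᴺ]^d`. -/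
noncomputable def gridCorner (N : ℕ) (i : Fin d → Fin (2 ^ (2 * N + 1))) : Point d :=
  fun j => -2 ^ N + (2 ^ N)⁻¹ * ((i j : ℕ) : ℝ)

/-- The infimum of `f` over the `i`-th dyadic cell. -/
noncomputable def gridInf (f : Point d → ℝ) (N : ℕ) (i : Fin d → Fin (2 ^ (2 * N + 1))) : ℝ :=
  sInf (f '' cube (gridCorner N i) (2 ^ N)⁻¹)

/-- The dyadic lower step function of `f` in the box `[-2ᴺ, 2ᴺ]^d`. -/
noncomputable def lowerStep (f : Point d → ℝ) (N : ℕ) (x : Point d) : ℝ :=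
  ∑ i, (cube (gridCorner N i) (2 ^ N)⁻¹).indicator (fun _ => gridInf f N i) x

theorem gridSide (N : ℕ) : (2 : ℝ) ^ (N + 1) / ((2 ^ (2 * N + 1) : ℕ) : ℝ) = (2 ^ N)⁻¹ := by
  push_cast
  field_simp
  ring

theorem gridInf_nonneg {f : Point d → ℝ} (hf : ∀ x, 0 ≤ f x) (N : ℕ)
    (i : Fin d → Fin (2 ^ (2 * N + 1))) : 0 ≤ gridInf f N i := by
  refine Real.sInf_nonneg ?_
  rintro _ ⟨x, -, rfl⟩
  exact hf x

theorem measurable_lowerStep (f : Point d → ℝ) (N : ℕ) : Measurable (lowerStep f N) :=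
  Finset.measurable_sum _ fun _ _ => measurable_const.indicator (measurableSet_cube _ _)

theorem integral_lowerStep (f : Point d → ℝ) (N : ℕ) :
    ∫ x, lowerStep f N x = ∑ i, gridInf f N i * ((2 ^ N)⁻¹) ^ d := by
  have hvol : ∀ i : Fin d → Fin (2 ^ (2 * N + 1)),
      volume (cube (gridCorner N i) (2 ^ N)⁻¹) = ENNReal.ofReal (((2 ^ N)⁻¹) ^ d) :=
    fun i => volume_cube _ (by positivity)
  simp only [lowerStep]
  rw [integral_finsetSum]
  · refine Finset.sum_congr rfl fun i _ => ?_
    rw [integral_indicator (measurableSet_cube _ _), setIntegral_const, measureReal_def, hvol,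
      ENNReal.toReal_ofReal (by positivity), smul_eq_mul, mul_comm]
  · intro i _
    rw [integrable_indicator_iff (measurableSet_cube _ _)]
    exact integrableOn_const (by rw [hvol]; exact ENNReal.ofReal_ne_top)

/-- This form puts the normalized lower step function into the density class: a cell has mass equal
to its infimum times its volume, divided by the total. -/
theorem stepDensity_lowerStep (f : Point d → ℝ) (N : ℕ) :
    (fun x => lowerStep f N x / ∫ y, lowerStep f N y) =
      stepDensity (fun _ => -2 ^ N) (2 ^ (N + 1)) (2 ^ (2 * N + 1))
        (fun i => gridInf f N i * ((2 ^ N)⁻¹) ^ d / ∫ y, lowerStep f N y) := by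
  funext x
  simp only [stepDensity, cellDensity, gridSide]
  rw [lowerStep, Finset.sum_div]
  refine Finset.sum_congr rfl fun i _ => ?_
  have h2 : ((2 : ℝ) ^ N)⁻¹ ^ d ≠ 0 := by positivity
  by_cases hx : x ∈ cube (gridCorner N i) (2 ^ N)⁻¹
  · have hx' : x ∈ cube (fun j => -2 ^ N + (2 ^ N)⁻¹ * ((i j : ℕ) : ℝ)) (2 ^ N)⁻¹ := hx
    rw [Set.indicator_of_mem hx, uniformDensity, Set.indicator_of_mem hx', div_mul_eq_mul_div,
      mul_assoc, mul_inv_cancel₀ h2, mul_one]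
  · have hx' : x ∉ cube (fun j => -2 ^ N + (2 ^ N)⁻¹ * ((i j : ℕ) : ℝ)) (2 ^ N)⁻¹ := hx
    rw [Set.indicator_of_notMem hx, uniformDensity, Set.indicator_of_notMem hx', zero_div, mul_zero]

/-- Points none of whose coordinates is a dyadic rational. -/
def NonDyadic (x : Point d) : Prop := ∀ (j : Fin d) (N : ℕ) (z : ℤ), x j ≠ (z : ℝ) / 2 ^ N

theorem ae_nonDyadic : ∀ᵐ x : Point d, NonDyadic x := by
  simp only [NonDyadic, ae_all_iff]
  exact fun j N z => Measure.ae_eval_ne (fun _ => volume) j _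

/-- Closed cells share faces, but away from the dyadic hyperplanes the floors determine the cell.
The shift `4 ^ N` is the half side `2 ^ N` of the box measured in units of `2⁻ᴺ`. -/
theorem dyadicCorner_eq_gridCorner {N : ℕ} {x : Point d} (hx : NonDyadic x)
    {i : Fin d → Fin (2 ^ (2 * N + 1))} (hi : x ∈ cube (gridCorner N i) (2 ^ N)⁻¹) (j : Fin d) :
    ⌊x j * 2 ^ N⌋ = ((i j : ℕ) : ℤ) - 4 ^ N := by
  obtain ⟨h1, h2⟩ := hi j
  simp only [gridCorner] at h1 h2
  have hp : (0 : ℝ) < 2 ^ N := by positivity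
  have h4 : (4 : ℝ) ^ N = 2 ^ N * 2 ^ N := by rw [← mul_pow]; norm_num
  have e1 : (-2 ^ N + (2 ^ N)⁻¹ * ((i j : ℕ) : ℝ)) * 2 ^ N = (i j : ℕ) - (4 : ℝ) ^ N := by
    rw [h4]
    field_simp
    ring
  have e2 : (-2 ^ N + (2 ^ N)⁻¹ * ((i j : ℕ) : ℝ) + (2 ^ N)⁻¹) * 2 ^ N =
      (i j : ℕ) - (4 : ℝ) ^ N + 1 := by
    rw [add_mul, e1, inv_mul_cancel₀ hp.ne']
  rw [Int.floor_eq_iff]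
  push_cast
  rw [← e2, ← e1]
  refine ⟨mul_le_mul_of_nonneg_right h1 hp.le, ?_⟩
  refine mul_lt_mul_of_pos_right (lt_of_le_of_ne h2 ?_) hp
  have h := hx j N (((i j : ℕ) : ℤ) - 4 ^ N + 1)
  rw [Ne, eq_div_iff hp.ne'] at h
  push_cast at h
  rw [← e2] at h
  exact fun h' => h (by rw [h'])

theorem mem_dyadicCube (N : ℕ) (x : Point d) : x ∈ dyadicCube N x := by
  have hp : (0 : ℝ) < 2 ^ N := by positivity
  intro j
  simp only [dyadicCorner]
  rw [Set.mem_Icc, div_le_iff₀ hp, ← sub_le_iff_le_add, le_div_iff₀ hp, sub_mul,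
    inv_mul_cancel₀ hp.ne']
  exact ⟨Int.floor_le _, by linarith [Int.lt_floor_add_one (x j * 2 ^ N)]⟩

/-- Off the dyadic hyperplanes at most one indicator in the sum is nonzero, so overlapping faces are
not counted twice. -/
theorem lowerStep_eq {f : Point d → ℝ} {N : ℕ} {x : Point d} (hx : NonDyadic x) :
    lowerStep f N x = if ∀ j, |x j| ≤ 2 ^ N then sInf (f '' dyadicCube N x) else 0 := by
  have hp : (0 : ℝ) < 2 ^ N := by positivity
  have h4 : (4 : ℝ) ^ N = 2 ^ N * 2 ^ N := by rw [← mul_pow]; norm_num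
  have hcorner : ∀ i : Fin d → Fin (2 ^ (2 * N + 1)),
      (∀ j, ⌊x j * 2 ^ N⌋ = ((i j : ℕ) : ℤ) - 4 ^ N) → dyadicCorner N x = gridCorner N i := by
    intro i hi
    funext j
    simp only [dyadicCorner, gridCorner, hi j]
    push_cast
    rw [h4]
    field_simp
    ring
  split_ifs with hbox
  · have hrange : ∀ j, 0 ≤ ⌊x j * 2 ^ N⌋ + 4 ^ N ∧ ⌊x j * 2 ^ N⌋ + 4 ^ N < 2 ^ (2 * N + 1) := by
      intro j
      obtain ⟨h1, h2⟩ := abs_le.1 (hbox j)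
      have h2' : x j < 2 ^ N := lt_of_le_of_ne h2 (by simpa using hx j 0 (2 ^ N))
      constructor
      · have : -(4 ^ N : ℤ) ≤ ⌊x j * 2 ^ N⌋ := by
          rw [Int.le_floor]
          push_cast
          nlinarith
        linarith
      · have : ⌊x j * 2 ^ N⌋ < (4 ^ N : ℤ) := by
          rw [Int.floor_lt]
          push_cast
          nlinarith
        have h5 : (2 : ℤ) ^ (2 * N + 1) = 4 ^ N + 4 ^ N := by
          rw [pow_succ, pow_mul]
          norm_num
          ring
        linarith
    set i₀ : Fin d → Fin (2 ^ (2 * N + 1)) := fun j => ⟨(⌊x j * 2 ^ N⌋ + 4 ^ N).toNat, by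
      have := hrange j
      zify
      rw [Int.toNat_of_nonneg this.1]
      exact this.2⟩ with hi₀
    have hfl : ∀ j, ⌊x j * 2 ^ N⌋ = ((i₀ j : ℕ) : ℤ) - 4 ^ N := by
      intro j
      simp only [hi₀]
      rw [Int.toNat_of_nonneg (hrange j).1]
      ring
    rw [lowerStep, Finset.sum_eq_single i₀]
    · rw [gridInf, ← hcorner i₀ hfl]
      exact Set.indicator_of_mem (mem_dyadicCube N x) _
    · intro i _ hne
      refine Set.indicator_of_notMem (fun hi => hne ?_) _
      funext j
      have h := dyadicCorner_eq_gridCorner hx hi j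
      have h' := hfl j
      ext
      omega
    · simp
  · refine Finset.sum_eq_zero fun i _ => Set.indicator_of_notMem (fun hi => hbox fun j => ?_) _
    obtain ⟨h1, h2⟩ := hi j
    simp only [gridCorner] at h1 h2
    have hij : (((i j : ℕ) : ℝ) + 1) ≤ 2 * 4 ^ N := by
      have h6 : (i j : ℕ) + 1 ≤ 2 * 4 ^ N :=
        (i j).2.trans_eq (by rw [pow_succ, pow_mul, mul_comm]; norm_num)
      exact_mod_cast h6
    rw [abs_le]
    constructor
    · have : 0 ≤ ((2 : ℝ) ^ N)⁻¹ * ((i j : ℕ) : ℝ) := by positivity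
      linarith
    · have : ((2 : ℝ) ^ N)⁻¹ * (((i j : ℕ) : ℝ) + 1) ≤ (2 ^ N)⁻¹ * (2 * 4 ^ N) := by gcongr
      have e : ((2 : ℝ) ^ N)⁻¹ * (2 * 4 ^ N) = 2 * 2 ^ N := by
        rw [h4]
        field_simp
      linarith

/-- Because `⌊2a⌋` is `2⌊a⌋` or `2⌊a⌋ + 1`. The nesting makes the infima increase with `N`. -/
theorem dyadicCube_succ_subset (N : ℕ) (x : Point d) : dyadicCube (N + 1) x ⊆ dyadicCube N x := by
  intro y hy j
  obtain ⟨h1, h2⟩ := hy j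
  have hp : (0 : ℝ) < 2 ^ N := by positivity
  set a := x j * 2 ^ N with ha
  have ha2 : x j * 2 ^ (N + 1) = 2 * a := by rw [ha, pow_succ]; ring
  have f1 : 2 * ⌊a⌋ ≤ ⌊2 * a⌋ := by
    rw [Int.le_floor]
    push_cast
    linarith [Int.floor_le a]
  have f2 : ⌊2 * a⌋ < 2 * ⌊a⌋ + 2 := by
    rw [Int.floor_lt]
    push_cast
    linarith [Int.lt_floor_add_one a]
  have f1' : (2 : ℝ) * ⌊a⌋ ≤ ⌊2 * a⌋ := by exact_mod_cast f1
  have f2' : (⌊2 * a⌋ : ℝ) + 1 ≤ 2 * ⌊a⌋ + 2 := by exact_mod_cast f2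
  simp only [dyadicCorner, ha2] at h1 h2
  rw [pow_succ] at h1 h2
  simp only [dyadicCorner, ← ha]
  constructor
  · refine le_trans ?_ h1
    rw [div_le_div_iff₀ hp (by positivity)]
    nlinarith
  · refine h2.trans ?_
    have e1 : (⌊2 * a⌋ : ℝ) / (2 ^ N * 2) + (2 ^ N * 2)⁻¹ = (⌊2 * a⌋ + 1) / (2 ^ N * 2) := by
      field_simp
    have e2 : (⌊a⌋ : ℝ) / 2 ^ N + (2 ^ N)⁻¹ = (2 * ⌊a⌋ + 2) / (2 ^ N * 2) := by
      field_simp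
    rw [e1, e2]
    gcongr

theorem dist_le_of_mem_dyadicCube {N : ℕ} {x y : Point d} (hy : y ∈ dyadicCube N x) :
    dist y x ≤ (2 ^ N)⁻¹ := by
  rw [dist_pi_le_iff (by positivity)]
  intro j
  obtain ⟨h1, h2⟩ := hy j
  obtain ⟨h3, h4⟩ := mem_dyadicCube N x j
  rw [Real.dist_eq, abs_le]
  constructor <;> linarith

section LowerStep

variable {f : Point d → ℝ}

theorem bddBelow_image (hf : ∀ x, 0 ≤ f x) (s : Set (Point d)) : BddBelow (f '' s) :=
  ⟨0, by rintro _ ⟨x, -, rfl⟩; exact hf x⟩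

theorem sInf_dyadicCube_le (hf : ∀ x, 0 ≤ f x) (N : ℕ) (x : Point d) : sInf (f '' dyadicCube N x) ≤ f x :=
  csInf_le (bddBelow_image hf _) ⟨x, mem_dyadicCube N x, rfl⟩

theorem lowerStep_nonneg (hf : ∀ x, 0 ≤ f x) (N : ℕ) (x : Point d) : 0 ≤ lowerStep f N x :=
  Finset.sum_nonneg fun i _ => Set.indicator_nonneg (fun _ _ => gridInf_nonneg hf N i) x

theorem lowerStep_le (hf : ∀ x, 0 ≤ f x) {x : Point d} (hx : NonDyadic x) (N : ℕ) : lowerStep f N x ≤ f x := by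
  rw [lowerStep_eq hx]
  split_ifs
  · exact sInf_dyadicCube_le hf N x
  · exact hf x

theorem monotone_lowerStep (hf : ∀ x, 0 ≤ f x) {x : Point d} (hx : NonDyadic x) :
    Monotone fun N => lowerStep f N x := by
  refine monotone_nat_of_le_succ fun N => ?_
  by_cases h : ∀ j, |x j| ≤ 2 ^ N
  · have h' : ∀ j, |x j| ≤ 2 ^ (N + 1) := fun j =>
      (h j).trans (pow_le_pow_right₀ one_le_two N.le_succ)
    rw [lowerStep_eq hx, lowerStep_eq hx, if_pos h, if_pos h']
    exact csInf_le_csInf (bddBelow_image hf _) ⟨_, x, mem_dyadicCube _ x, rfl⟩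
      (Set.image_mono (dyadicCube_succ_subset N x))
  · rw [lowerStep_eq hx, if_neg h]
    exact lowerStep_nonneg hf _ x

/-- The box eventually contains `x`, and the cube around `x` eventually lies in a ball on which `f`
stays above `f x - ε / 2`. -/
theorem tendsto_lowerStep (hf : ∀ x, 0 ≤ f x) {x : Point d} (hx : NonDyadic x) (hc : ContinuousAt f x) :
    Tendsto (fun N => lowerStep f N x) atTop (𝓝 (f x)) := by
  have h2 : Tendsto (fun N : ℕ => (2 : ℝ) ^ N) atTop atTop :=
    tendsto_pow_atTop_atTop_of_one_lt one_lt_two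
  rw [Metric.tendsto_atTop']
  intro ε hε
  obtain ⟨δ, hδ, hball⟩ := Metric.continuousAt_iff.1 hc (ε / 2) (half_pos hε)
  have h3 : ∀ᶠ N : ℕ in atTop, ∀ j, |x j| ≤ 2 ^ N :=
    eventually_all.2 fun j => h2.eventually_ge_atTop _
  have h4 : ∀ᶠ N : ℕ in atTop, ((2 : ℝ) ^ N)⁻¹ < δ :=
    (tendsto_inv_atTop_zero.comp h2).eventually_lt_const hδ
  obtain ⟨N₀, hN₀⟩ := eventually_atTop.1 (h3.and h4)
  refine ⟨N₀, fun N hN => ?_⟩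
  obtain ⟨hb, hs⟩ := hN₀ N hN.le
  rw [lowerStep_eq hx, if_pos hb, Real.dist_eq, abs_sub_comm,
    abs_of_nonneg (sub_nonneg.2 (sInf_dyadicCube_le hf N x))]
  have : f x - ε / 2 ≤ sInf (f '' dyadicCube N x) := by
    refine le_csInf ⟨_, x, mem_dyadicCube _ x, rfl⟩ ?_
    rintro _ ⟨y, hy, rfl⟩
    have := hball ((dist_le_of_mem_dyadicCube hy).trans_lt hs)
    rw [Real.dist_eq, abs_lt] at this
    linarith
  linarith

end LowerStep

/-! ### The Poisson limit for almost everywhere continuous densities. -/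

theorem IsDensity.integrable {f : Point d → ℝ} (hf : IsDensity f) : Integrable f :=
  ⟨hf.1.aestronglyMeasurable, by
    rw [hasFiniteIntegral_iff_ofReal (ae_of_all _ hf.2.1), hf.2.2]
    exact ENNReal.one_lt_top⟩

theorem IsDensity.integral_eq_one {f : Point d → ℝ} (hf : IsDensity f) : ∫ x, f x = 1 := by
  rw [integral_eq_lintegral_of_nonneg_ae (ae_of_all _ hf.2.1) hf.1.aestronglyMeasurable, hf.2.2,
    ENNReal.toReal_one]

/-- The law of large numbers in mean for the Poisson process with an almost everywhere continuous
density. -/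
theorem tendsto_poissonMean {H : Functional d} {𝒟 : Set (Point d → ℝ)} {Hstar : ℝ}
    (hd : 1 ≤ d) (hmeas : IsMeasurable H)
    (h𝒟 : IsDensityClass 𝒟) (hpos : 0 < Hstar) (htrans : TranslationInvariant H)
    (hscale : ScaleInvariant H Hstar) (hhom : Homogeneous H 𝒟) (hadd : AsymptoticallyAdditive H)
    (hcont : ContinuousFromBelow H 𝒟) {f : Point d → ℝ} (hf : f ∈ 𝒟)
    (hfcont : ∀ᵐ x, ContinuousAt f x) :
    Tendsto (fun ν : ℝ => 1 / ν * poissonMean (H ν) ν f) atTop (𝓝 Hstar) := by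
  have hfd := h𝒟.1 f hf
  have hf0 := hfd.2.1
  set Z : ℕ → ℝ := fun N => ∫ x, lowerStep f N x with hZ
  have hZlim : Tendsto Z atTop (𝓝 1) := by
    rw [← hfd.integral_eq_one]
    refine tendsto_integral_of_dominated_convergence f
      (fun N => (measurable_lowerStep f N).aestronglyMeasurable) hfd.integrable (fun N => ?_) ?_
    · filter_upwards [ae_nonDyadic] with x hx
      rw [Real.norm_of_nonneg (lowerStep_nonneg hf0 N x)]
      exact lowerStep_le hf0 hx N
    · filter_upwards [ae_nonDyadic, hfcont] with x hx hc using tendsto_lowerStep hf0 hx hc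
  have hZle : ∀ N, Z N ≤ 1 := fun N => by
    rw [← hfd.integral_eq_one]
    refine integral_mono_of_nonneg (ae_of_all _ (lowerStep_nonneg hf0 N)) hfd.integrable ?_
    filter_upwards [ae_nonDyadic] with x hx using lowerStep_le hf0 hx N
  -- The first lower step functions may vanish almost everywhere and then have no normalization.
  -- Starting at `N₀` avoids them.
  obtain ⟨N₀, hN₀⟩ := eventually_atTop.1 (hZlim.eventually_const_lt (zero_lt_one' ℝ))
  have hmass : ∀ N, 0 < Z N → (∀ i, 0 ≤ gridInf f N i * ((2 ^ N)⁻¹) ^ d / Z N) ∧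
      ∑ i, gridInf f N i * ((2 ^ N)⁻¹) ^ d / Z N = 1 := by
    intro N hN
    refine ⟨fun i => div_nonneg (mul_nonneg (gridInf_nonneg hf0 N i) (by positivity)) hN.le, ?_⟩
    rw [← Finset.sum_div, ← integral_lowerStep]
    exact div_self hN.ne'
  have hgrid : ∀ N, 1 < 2 ^ (2 * N + 1) := fun N => Nat.one_lt_pow (by omega) one_lt_two
  have hstep : ∀ N, 0 < Z N → (fun x => lowerStep f N x / Z N) ∈ 𝒟 := by
    intro N hN
    have h := hmass N hN
    rw [hZ, stepDensity_lowerStep]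
    exact h𝒟.2 _ _ _ _ (by positivity) (hgrid N).le h.1 h.2
  -- The approximating process has intensity `Z N * ν`, so its limit is `Z N * Hstar`. The missing
  -- factor is harmless as `Z N → 1`.
  have hlim : ∀ N, 0 < Z N → Tendsto (fun ν : ℝ => 1 / ν *
      poissonMean (H ν) (Z N * ν) (fun x => lowerStep f N x / Z N)) atTop (𝓝 (Z N * Hstar)) := by
    intro N hN
    refine hhom.tendsto_thinned hpos (hstep N hN) ?_ hN (hZle N)
    have h := hmass N hN
    rw [hZ, stepDensity_lowerStep]
    exact tendsto_poissonMean_stepDensity hd hmeas h𝒟 hpos htrans hscale hhom hadd _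
      (by positivity) (hgrid N) h.1 h.2
  rw [Metric.tendsto_nhds]
  intro ε hε
  have hc := hcont f hf (fun i => lowerStep f (i + N₀)) (fun i => measurable_lowerStep f _)
    (by
      filter_upwards [ae_nonDyadic, hfcont] with x hx hc
      exact ⟨fun i => lowerStep_nonneg hf0 _ x,
        fun i j hij => monotone_lowerStep hf0 hx (Nat.add_le_add_right hij N₀),
        (tendsto_add_atTop_iff_nat N₀).2 (tendsto_lowerStep hf0 hx hc)⟩)
    (fun i => hstep _ (hN₀ _ (Nat.le_add_left _ _))) (ε / 4) (by positivity)
  have hZ2 : Tendsto (fun i => Z (i + N₀) * Hstar) atTop (𝓝 Hstar) := by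
    simpa using ((tendsto_add_atTop_iff_nat N₀).2 hZlim).mul_const Hstar
  obtain ⟨i, hi1, hi2⟩ := (hc.and (Metric.tendsto_nhds.1 hZ2 (ε / 4) (by positivity))).exists
  filter_upwards [hi1, Metric.tendsto_nhds.1 (hlim (i + N₀) (hN₀ _ (Nat.le_add_left _ _)))
    (ε / 4) (by positivity), eventually_gt_atTop 0] with ν h1 h2 hν
  rw [← abs_of_pos (by positivity : 0 < 1 / ν), ← abs_mul, mul_sub] at h1
  rw [Real.dist_eq] at hi2 h2 ⊢
  have h3 := abs_le.1 h1
  have h4 := abs_lt.1 h2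
  have h5 := abs_lt.1 hi2
  rw [abs_lt]
  constructor <;> linarith [h3.1, h3.2, h4.1, h4.2, h5.1, h5.2]

/-! ### Poisson averages and their comparison with the diagonal. -/

/-- The Poisson probabilities. -/
noncomputable def poissonWeight (ν : ℝ) (k : ℕ) : ℝ := Real.exp (-ν) * ν ^ k / k !

theorem poissonWeight_nonneg {ν : ℝ} (hν : 0 ≤ ν) (k : ℕ) : 0 ≤ poissonWeight ν k := by
  unfold poissonWeight
  positivity

/-- The generating function. All Poisson tail and deviation estimates below are read off from it at
`t = 1/2`, `t = 2` and `t = exp (±s)`. -/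
theorem hasSum_poissonWeight_mul_pow (ν t : ℝ) :
    HasSum (fun k => poissonWeight ν k * t ^ k) (Real.exp (ν * (t - 1))) := by
  have h := (NormedSpace.expSeries_div_hasSum_exp (ν * t)).mul_left (Real.exp (-ν))
  rw [← Real.exp_eq_exp_ℝ, ← Real.exp_add] at h
  have e1 : (fun k => poissonWeight ν k * t ^ k) =
      fun k : ℕ => Real.exp (-ν) * ((ν * t) ^ k / (k ! : ℝ)) := by
    funext k
    rw [poissonWeight, mul_pow]
    ring
  rw [e1, show ν * (t - 1) = -ν + ν * t by ring]
  exact h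

theorem hasSum_poissonWeight (ν : ℝ) : HasSum (poissonWeight ν) 1 := by
  simpa using hasSum_poissonWeight_mul_pow ν 1

/-- The majorant `B` makes `G` integrable under the Poisson law. Without integrability the Bochner
integral would be the default value `0` and need not split over the number of points. -/
theorem hasSum_poissonMean {G : Finset (Point d) → ℝ} (hG : BorelInPoints G) {ν : ℝ} (hν : 0 ≤ ν)
    {f : Point d → ℝ} (hf : IsDensity f) {B : ℕ → ℝ}
    (hB : ∀ k, ∀ᵐ x : Fin k → Point d ∂Measure.pi fun _ => densityMeasure f,
      |G (Finset.univ.image x)| ≤ B k)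
    (hsum : Summable fun k => poissonWeight ν k * B k) :
    HasSum (fun k => poissonWeight ν k *
      ∫ x : Fin k → Point d, G (Finset.univ.image x) ∂Measure.pi fun _ => densityMeasure f)
      (poissonMean G ν f) := by
  have := hf.isProbabilityMeasure
  have hw : ∀ k, (poissonMeasure ν.toNNReal {k}).toReal = poissonWeight ν k := by
    intro k
    rw [poissonMeasure_singleton, ENNReal.toReal_ofReal (by positivity), Real.coe_toNNReal _ hν]
    rfl
  have hint : ∀ k, Integrable (fun x : Fin k → Point d => G (Finset.univ.image x))
      (Measure.pi fun _ => densityMeasure f) := fun k =>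
    Integrable.of_bound (hG k).aestronglyMeasurable (B k) (hB k)
  have hmeasG := hG.measurable_points
  have hmap : ∀ (k : ℕ) (F : ℝ → ℝ), Measurable F → ∫ ω, F (G (points ω))
      ∂(poissonMeasure ν.toNNReal {k} •
        (Measure.pi fun _ : Fin k => densityMeasure f).map fun x => (⟨k, x⟩ : Config d)) =
      poissonWeight ν k * ∫ x : Fin k → Point d, F (G (Finset.univ.image x))
        ∂Measure.pi fun _ => densityMeasure f := by
    intro k F hF
    rw [integral_smul_measure, hw, smul_eq_mul]
    congr 1
    exact integral_map (f := fun ω : Config d => F (G (points ω)))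
      (measurable_configMk k).aemeasurable (hF.comp hmeasG).aestronglyMeasurable
  have hI : Integrable (fun ω => G (points ω)) (poissonLaw ν f) := by
    refine integrable_sum_measure (fun k => ?_) ?_
    · refine Integrable.smul_measure ?_ (measure_ne_top _ _)
      exact (integrable_map_measure hmeasG.aestronglyMeasurable
        (measurable_configMk k).aemeasurable).2 (hint k)
    · refine Summable.of_nonneg_of_le (fun k => integral_nonneg fun _ => norm_nonneg _)
        (fun k => ?_) hsum
      rw [hmap k (fun r => ‖r‖) measurable_norm]
      refine mul_le_mul_of_nonneg_left ?_ (poissonWeight_nonneg hν k)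
      refine (integral_mono_ae (hint k).norm (integrable_const (B k)) (hB k)).trans_eq ?_
      simp
  have h := hasSum_integral_measure hI
  have h2 := funext fun k => hmap k (fun r => r) measurable_id
  rw [h2] at h
  exact h

theorem exists_rpow_le_pow (q : ℝ) {r : ℝ} (hr : 1 < r) :
    ∃ K : ℝ, 0 < K ∧ ∀ k : ℕ, (k : ℝ) ^ q ≤ K * r ^ k := by
  have h := (tendsto_rpow_mul_exp_neg_mul_atTop_nhds_zero q (Real.log r) (Real.log_pos hr)).comp
    tendsto_natCast_atTop_atTop
  obtain ⟨K, hK⟩ := h.bddAbove_range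
  refine ⟨max K 1, lt_max_of_lt_right one_pos, fun k => ?_⟩
  have hk := hK ⟨k, rfl⟩
  simp only [Function.comp_apply] at hk
  have hexp : Real.exp (-Real.log r * k) = (r ^ k)⁻¹ := by
    rw [neg_mul, Real.exp_neg, mul_comm, Real.exp_nat_mul, Real.exp_log (by linarith)]
  rw [hexp, ← div_eq_mul_inv, div_le_iff₀ (by positivity)] at hk
  exact hk.trans (mul_le_mul_of_nonneg_right (le_max_left _ _) (by positivity))

/-- Substituting `x = n ^ a` turns this into the decay of `x ^ (p / a) * exp (-x)`. -/
theorem tendsto_rpow_mul_exp_neg_rpow (p : ℝ) {a : ℝ} (ha : 0 < a) :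
    Tendsto (fun n : ℕ => (n : ℝ) ^ p * Real.exp (-(n : ℝ) ^ a)) atTop (𝓝 0) := by
  have h := (tendsto_rpow_mul_exp_neg_mul_atTop_nhds_zero (p / a) 1 one_pos).comp
    ((tendsto_rpow_atTop ha).comp tendsto_natCast_atTop_atTop)
  refine h.congr fun n => ?_
  simp only [Function.comp_apply, neg_mul, one_mul]
  rw [← Real.rpow_mul (Nat.cast_nonneg n), mul_div_cancel₀ _ ha.ne']

theorem abs_le_exp_add_exp_div {s : ℝ} (hs : 0 < s) (x : ℝ) :
    |x| ≤ (Real.exp (s * x) + Real.exp (-(s * x))) / s := by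
  rw [le_div_iff₀ hs, ← abs_of_pos hs, ← abs_mul, abs_of_pos hs, abs_le]
  have h1 := Real.add_one_le_exp (s * x)
  have h2 := Real.add_one_le_exp (-(s * x))
  have h3 := Real.exp_pos (s * x)
  have h4 := Real.exp_pos (-(s * x))
  constructor <;> linarith

/-- The mean absolute deviation of a Poisson variable, bounded through its exponential moments. -/
theorem exists_bound_abs_deviation {n : ℕ} (hn : 1 ≤ n) :
    ∃ β : ℕ → ℝ, (∀ k : ℕ, |(k : ℝ) - n| ≤ β k) ∧
      ∃ S, HasSum (fun k => poissonWeight n k * β k) S ∧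
        S ≤ 2 * Real.exp 1 * (n : ℝ) ^ (1 / 2 : ℝ) := by
  have hn0 : (0 : ℝ) < n := by exact_mod_cast hn
  -- With `s = n ^ (-1/2)` the exponents `n * (exp (±s) - 1 ∓ s)` are at most `n * s ^ 2 = 1`. Both
  -- exponential moments are therefore at most `e`, and dividing by `s` produces `n ^ (1/2)`.
  set s : ℝ := (n : ℝ) ^ (-(1 / 2) : ℝ) with hs
  have hs0 : 0 < s := Real.rpow_pos_of_pos hn0 _
  have hs1 : s ≤ 1 := Real.rpow_le_one_of_one_le_of_nonpos (by exact_mod_cast hn) (by norm_num)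
  have hsn : n * s ^ 2 = 1 := by
    rw [hs, ← Real.rpow_natCast, ← Real.rpow_mul hn0.le]
    norm_num
    rw [Real.rpow_neg_one, mul_inv_cancel₀ hn0.ne']
  have hsinv : s⁻¹ = (n : ℝ) ^ (1 / 2 : ℝ) := by
    rw [hs, ← Real.rpow_neg hn0.le, neg_neg]
  have hexp : ∀ t : ℝ, |t| = s → n * (Real.exp t - 1) - t * n ≤ 1 := by
    intro t ht
    have h := Real.abs_exp_sub_one_sub_id_le (x := t) (by rw [ht]; exact hs1)
    have h2 := (abs_le.1 h).2
    have h3 : t ^ 2 = s ^ 2 := by rw [← ht, sq_abs]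
    calc n * (Real.exp t - 1) - t * n = n * (Real.exp t - 1 - t) := by ring
      _ ≤ n * s ^ 2 := by rw [← h3]; exact mul_le_mul_of_nonneg_left h2 hn0.le
      _ = 1 := hsn
  have hsum : ∀ t : ℝ, HasSum (fun k : ℕ => poissonWeight n k * Real.exp (t * (k - n)))
      (Real.exp (n * (Real.exp t - 1) - t * n)) := by
    intro t
    have h := (hasSum_poissonWeight_mul_pow n (Real.exp t)).mul_right (Real.exp (-(t * n)))
    rw [← Real.exp_add, ← sub_eq_add_neg] at h
    have e : (fun k : ℕ => poissonWeight n k * Real.exp (t * (k - n))) =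
        fun k : ℕ => poissonWeight n k * Real.exp t ^ k * Real.exp (-(t * n)) := by
      funext k
      rw [← Real.exp_nat_mul, mul_assoc, ← Real.exp_add]
      congr 2
      ring
    rw [e]
    exact h
  refine ⟨fun k => (Real.exp (s * (k - n)) + Real.exp (-(s * (k - n)))) / s,
    fun k => abs_le_exp_add_exp_div hs0 _, (Real.exp (n * (Real.exp s - 1) - s * n) +
      Real.exp (n * (Real.exp (-s) - 1) - -s * n)) / s, ?_, ?_⟩
  · have e : (fun k : ℕ => poissonWeight n k *
        ((Real.exp (s * (k - n)) + Real.exp (-(s * (k - n)))) / s)) = fun k : ℕ =>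
        (poissonWeight n k * Real.exp (s * (k - n)) +
          poissonWeight n k * Real.exp (-s * (k - n))) / s := by
      funext k
      rw [neg_mul]
      ring
    rw [e]
    exact ((hsum s).add (hsum (-s))).div_const s
  · rw [div_eq_mul_inv, hsinv]
    refine mul_le_mul_of_nonneg_right ?_ (by positivity)
    have h1 := Real.exp_le_exp.2 (hexp s (abs_of_pos hs0))
    have h2 := Real.exp_le_exp.2 (hexp (-s) (by rw [abs_neg, abs_of_pos hs0]))
    linarith

/-- Comparison of the Poisson average of a double sequence with its diagonal. -/
theorem tendsto_poisson_average_sub_diagonal {h : ℕ → ℕ → ℝ} {S : ℕ → ℝ} {C q C' b a : ℝ}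
    (hC : 0 < C) (hq : 0 < q) (hC' : 0 < C') (hb : b < 1 / 2) (ha : 0 < a)
    (hbound : ∀ n k : ℕ, 1 ≤ n → |h n k| ≤ C * (max n k : ℝ) ^ q)
    (hdiff : ∀ n k : ℕ, 1 ≤ n → 0 < k → k < 2 * n → |h n k - h n n| ≤
      C' * |(k : ℝ) - n| * (n : ℝ) ^ b + 2 * C * (2 * n : ℝ) ^ q * Real.exp (-(n : ℝ) ^ a))
    (hS : ∀ n : ℕ, 1 ≤ n → HasSum (fun k => poissonWeight n k * h n k) (S n)) :
    Tendsto (fun n : ℕ => 1 / (n : ℝ) * (S n - h n n)) atTop (𝓝 0) := by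
  obtain ⟨K, hK, hKle⟩ := exists_rpow_le_pow q (r := 10 / 9) (by norm_num)
  have key : ∀ n : ℕ, 1 ≤ n → |S n - h n n| ≤ C' * (n : ℝ) ^ b * (2 * Real.exp 1 *
      (n : ℝ) ^ (1 / 2 : ℝ)) + 2 * C * (2 * n : ℝ) ^ q * Real.exp (-(n : ℝ) ^ a) +
      2 * C * (n : ℝ) ^ q * Real.exp (-(1 / 2) * n) +
      2 * C * K * (Real.exp 1 / (81 / 25)) ^ n := by
    intro n hn
    have hn0 : (0 : ℝ) < n := by exact_mod_cast hn
    obtain ⟨β, hβ, T, hT, hTle⟩ := exists_bound_abs_deviation hn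
    have hsum := hasSum_poissonWeight (n : ℝ)
    -- Four majorants are summed: the deviation of `k` from `n` for `0 < k < 2 * n`, the exceptional
    -- events, the term `k = 0` (where `(1/2) ^ k = 1`), and the tail `k ≥ 2 * n`.
    have s1 := (hT.mul_left (C' * (n : ℝ) ^ b)).add
      (hsum.mul_left (2 * C * (2 * n : ℝ) ^ q * Real.exp (-(n : ℝ) ^ a)))
    have s2 := (s1.add ((hasSum_poissonWeight_mul_pow n (1 / 2)).mul_left
      (2 * C * (n : ℝ) ^ q))).add ((hasSum_poissonWeight_mul_pow n 2).mul_left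
      (2 * C * K * ((81 / 25 : ℝ) ^ n)⁻¹))
    have s3 := (hS n hn).sub (hsum.mul_right (h n n))
    rw [one_mul] at s3
    have hterm : ∀ k, |poissonWeight n k * h n k - poissonWeight n k * h n n| ≤
        C' * (n : ℝ) ^ b * (poissonWeight n k * β k) +
        2 * C * (2 * n : ℝ) ^ q * Real.exp (-(n : ℝ) ^ a) * poissonWeight n k +
        2 * C * (n : ℝ) ^ q * (poissonWeight n k * (1 / 2) ^ k) +
        2 * C * K * ((81 / 25 : ℝ) ^ n)⁻¹ * (poissonWeight n k * 2 ^ k) := by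
      intro k
      have hw := poissonWeight_nonneg hn0.le k
      have hβk : 0 ≤ β k := (abs_nonneg _).trans (hβ k)
      rw [← mul_sub, abs_mul, abs_of_nonneg hw]
      suffices hs : |h n k - h n n| ≤ C' * (n : ℝ) ^ b * β k +
          2 * C * (2 * n : ℝ) ^ q * Real.exp (-(n : ℝ) ^ a) +
          2 * C * (n : ℝ) ^ q * (1 / 2) ^ k + 2 * C * K * ((81 / 25 : ℝ) ^ n)⁻¹ * 2 ^ k by
        refine (mul_le_mul_of_nonneg_left hs hw).trans_eq ?_
        ring
      have p1 : 0 ≤ C' * (n : ℝ) ^ b * β k := by positivity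
      have p2 : 0 ≤ 2 * C * (2 * n : ℝ) ^ q * Real.exp (-(n : ℝ) ^ a) := by positivity
      have p3 : 0 ≤ 2 * C * (n : ℝ) ^ q * (1 / 2) ^ k := by positivity
      have p4 : 0 ≤ 2 * C * K * ((81 / 25 : ℝ) ^ n)⁻¹ * 2 ^ k := by positivity
      have hdiag := hbound n n hn
      rw [max_self] at hdiag
      have htri := abs_sub (h n k) (h n n)
      -- `hdiff` leaves out `k = 0`. The crude bound suffices there because the Poisson weight at
      -- zero is exponentially small.
      rcases Nat.eq_zero_or_pos k with rfl | hk
      · have h0 := hbound n 0 hn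
        rw [max_eq_left (by simp)] at h0
        rw [pow_zero, mul_one] at *
        linarith
      · rcases lt_or_ge k (2 * n) with hk2 | hk2
        · have h1 := hdiff n k hn hk hk2
          have h2 : C' * |(k : ℝ) - n| * (n : ℝ) ^ b ≤ C' * (n : ℝ) ^ b * β k := by
            rw [mul_right_comm]
            exact mul_le_mul_of_nonneg_left (hβ k) (by positivity)
          linarith
        · have hnk : (n : ℝ) ≤ k := by exact_mod_cast (by omega : n ≤ k)
          have h0 := hbound n k hn
          rw [max_eq_right hnk] at h0
          have h1 : (n : ℝ) ^ q ≤ (k : ℝ) ^ q := Real.rpow_le_rpow hn0.le hnk hq.le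
          -- The constants satisfy `(10/9) * (9/5) = 2` and `(9/5) ^ 2 = 81/25`. The second moves `k
          -- ≥ 2 * n` into a power of `n`, and after summation the tail is `(e / (81/25)) ^ n`,
          -- which decays because `e < 3 < 81/25`.
          have h2 : (10 / 9 : ℝ) ^ k ≤ ((81 / 25 : ℝ) ^ n)⁻¹ * 2 ^ k := by
            rw [inv_mul_eq_div, le_div_iff₀ (by positivity)]
            calc (10 / 9 : ℝ) ^ k * (81 / 25) ^ n = (10 / 9 : ℝ) ^ k * (9 / 5) ^ (2 * n) := by
                  rw [pow_mul]; norm_num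
              _ ≤ (10 / 9 : ℝ) ^ k * (9 / 5) ^ k := by gcongr; norm_num
              _ = 2 ^ k := by rw [← mul_pow]; norm_num
          have h3 : C * (k : ℝ) ^ q ≤ C * (K * (((81 / 25 : ℝ) ^ n)⁻¹ * 2 ^ k)) :=
            mul_le_mul_of_nonneg_left ((hKle k).trans (mul_le_mul_of_nonneg_left h2 hK.le)) hC.le
          have h4 : C * (n : ℝ) ^ q ≤ C * (k : ℝ) ^ q := mul_le_mul_of_nonneg_left h1 hC.le
          linarith
    have hle := tsum_of_norm_bounded (f := fun k => poissonWeight n k * h n k -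
      poissonWeight n k * h n n) s2 hterm
    rw [s3.tsum_eq, Real.norm_eq_abs] at hle
    refine hle.trans ?_
    have e1 : Real.exp (n * (1 / 2 - 1)) = Real.exp (-(1 / 2) * n) := by
      congr 1
      ring
    have e2 : ((81 / 25 : ℝ) ^ n)⁻¹ * Real.exp (n * (2 - 1)) = (Real.exp 1 / (81 / 25)) ^ n := by
      rw [show (n : ℝ) * (2 - 1) = n * 1 by ring, Real.exp_nat_mul, ← inv_pow, ← mul_pow,
        inv_mul_eq_div]
    have h1 := mul_le_mul_of_nonneg_left hTle (by positivity : 0 ≤ C' * (n : ℝ) ^ b)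
    rw [e1, mul_assoc (2 * C * K), e2, mul_one]
    linarith
  have t1 : Tendsto (fun n : ℕ => C' * (2 * Real.exp 1) * (n : ℝ) ^ (-(1 / 2 - b)))
      atTop (𝓝 0) := by
    simpa using ((tendsto_rpow_neg_atTop (by linarith : 0 < 1 / 2 - b)).comp
      tendsto_natCast_atTop_atTop).const_mul (C' * (2 * Real.exp 1))
  have t2 : Tendsto (fun n : ℕ => 2 * C * (2 * n : ℝ) ^ q * Real.exp (-(n : ℝ) ^ a))
      atTop (𝓝 0) := by
    have := (tendsto_rpow_mul_exp_neg_rpow q ha).const_mul (2 * C * 2 ^ q)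
    rw [mul_zero] at this
    refine this.congr fun n => ?_
    rw [Real.mul_rpow two_pos.le (Nat.cast_nonneg n)]
    ring
  have t3 : Tendsto (fun n : ℕ => 2 * C * (n : ℝ) ^ q * Real.exp (-(1 / 2) * n)) atTop (𝓝 0) := by
    have := ((tendsto_rpow_mul_exp_neg_mul_atTop_nhds_zero q (1 / 2) (by norm_num)).comp
      tendsto_natCast_atTop_atTop).const_mul (2 * C)
    rw [mul_zero] at this
    refine this.congr fun n => ?_
    simp only [Function.comp_apply]
    ring
  have t4 : Tendsto (fun n : ℕ => 2 * C * K * (Real.exp 1 / (81 / 25)) ^ n) atTop (𝓝 0) := by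
    have h3 := Real.exp_one_lt_three
    simpa using (tendsto_pow_atTop_nhds_zero_of_lt_one (r := Real.exp 1 / (81 / 25))
      (by positivity) (by rw [div_lt_one (by norm_num)]; linarith)).const_mul (2 * C * K)
  have t5 := t1.add ((tendsto_one_div_atTop_nhds_zero_nat (𝕜 := ℝ)).mul ((t2.add t3).add t4))
  simp only [add_zero, mul_zero] at t5
  refine squeeze_zero_norm' ?_ t5
  filter_upwards [eventually_ge_atTop 1] with n hn
  have hn0 : (0 : ℝ) < n := by exact_mod_cast hn
  rw [norm_mul, Real.norm_eq_abs, Real.norm_eq_abs, abs_of_pos (by positivity : 0 < 1 / (n : ℝ))]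
  refine (mul_le_mul_of_nonneg_left (key n hn) (by positivity)).trans_eq ?_
  have e : (n : ℝ) ^ (-(1 / 2 - b)) = 1 / n * ((n : ℝ) ^ b * (n : ℝ) ^ (1 / 2 : ℝ)) := by
    rw [show 1 / (n : ℝ) = (n : ℝ) ^ (-1 : ℝ) by rw [Real.rpow_neg_one, one_div], ← Real.rpow_add hn0, ← Real.rpow_add hn0]
    congr 1
    ring
  rw [e]
  ring

/-! ### The Efron–Stein inequality and fourth moments. -/

section EfronStein

variable {E : Type*} [MeasurableSpace E]

theorem integrable_of_abs_le {μ : Measure E} [IsFiniteMeasure μ] {u : E → ℝ} (hu : Measurable u)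
    {B : ℝ} (hB : ∀ x, |u x| ≤ B) : Integrable u μ :=
  Integrable.of_bound hu.aestronglyMeasurable B (ae_of_all _ hB)

theorem integrable_sq_of_abs_le {μ : Measure E} [IsFiniteMeasure μ] {u : E → ℝ}
    (hu : Measurable u) {B : ℝ} (hB : ∀ x, |u x| ≤ B) : Integrable (fun x => u x ^ 2) μ :=
  integrable_of_abs_le (hu.pow_const 2) (B := B ^ 2) fun x => by
    rw [abs_pow]
    exact pow_le_pow_left₀ (abs_nonneg _) (hB x) 2

theorem integral_sub_const_sq {μ : Measure E} [IsProbabilityMeasure μ] {u : E → ℝ}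
    (hu : Measurable u) {B : ℝ} (hB : ∀ x, |u x| ≤ B) (c : ℝ) :
    ∫ x, (u x - c) ^ 2 ∂μ = ∫ x, u x ^ 2 ∂μ - (∫ x, u x ∂μ) ^ 2 + (∫ x, u x ∂μ - c) ^ 2 := by
  have h1 := integrable_of_abs_le (μ := μ) hu hB
  have h2 := integrable_sq_of_abs_le (μ := μ) hu hB
  have e : ∀ x, (u x - c) ^ 2 = u x ^ 2 - 2 * c * u x + c ^ 2 := fun x => by ring
  have h3 : Integrable (fun x => u x ^ 2 - 2 * c * u x) μ := h2.sub (h1.const_mul _)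
  simp_rw [e]
  rw [integral_add h3 (integrable_const _),
    integral_sub h2 (h1.const_mul _), integral_const_mul, integral_const]
  simp only [probReal_univ, one_smul]
  ring

theorem sq_integral_le_integral_sq {μ : Measure E} [IsProbabilityMeasure μ] {u : E → ℝ}
    (hu : Measurable u) {B : ℝ} (hB : ∀ x, |u x| ≤ B) :
    (∫ x, u x ∂μ) ^ 2 ≤ ∫ x, u x ^ 2 ∂μ := by
  have h := integral_sub_const_sq (μ := μ) hu hB (∫ x, u x ∂μ)
  have h2 : 0 ≤ ∫ x, (u x - ∫ x, u x ∂μ) ^ 2 ∂μ := integral_nonneg fun _ => sq_nonneg _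
  rw [h, sub_self] at h2
  linarith

theorem abs_integral_le_of_abs_le {μ : Measure E} [IsProbabilityMeasure μ] {u : E → ℝ}
    {B : ℝ} (hB : ∀ x, |u x| ≤ B) : |∫ x, u x ∂μ| ≤ B := by
  simpa using norm_integral_le_of_norm_le_const (μ := μ) (f := u) (ae_of_all _ hB)

theorem measurable_cons (n : ℕ) :
    Measurable fun p : E × (Fin n → E) => (Fin.cons p.1 p.2 : Fin (n + 1) → E) := by
  refine measurable_pi_lambda _ fun i => ?_
  refine Fin.cases ?_ (fun j => ?_) i
  · simpa using measurable_fst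
  · exact (measurable_pi_apply j).comp measurable_snd

theorem integral_pi_succ (μ : Measure E) [IsProbabilityMeasure μ] (n : ℕ)
    {u : (Fin (n + 1) → E) → ℝ} (hu : Measurable u) {B : ℝ} (hB : ∀ x, |u x| ≤ B) :
    ∫ x, u x ∂Measure.pi (fun _ => μ) =
      ∫ z : Fin n → E, ∫ a, u (Fin.cons a z) ∂μ ∂Measure.pi (fun _ => μ) := by
  rw [← ((measurePreserving_piFinSuccAbove (fun _ : Fin (n + 1) => μ) 0).symm).integral_comp',
    integral_prod_symm]
  · simp [MeasurableEquiv.piFinSuccAbove_symm_apply, Fin.insertNthEquiv]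
  · exact integrable_of_abs_le (hu.comp (MeasurableEquiv.measurable _)) fun x => hB _

theorem measurable_integral_cons (μ : Measure E) [IsProbabilityMeasure μ] (n : ℕ)
    {u : (Fin (n + 1) → E) → ℝ} (hu : Measurable u) :
    Measurable fun z : Fin n → E => ∫ a, u (Fin.cons a z) ∂μ := by
  have h : StronglyMeasurable fun p : (Fin n → E) × E => u (Fin.cons p.2 p.1) :=
    (hu.comp ((measurable_cons n).comp measurable_swap)).stronglyMeasurable
  exact h.integral_prod_right.measurable

theorem measurable_cons_left (n : ℕ) (z : Fin n → E) :
    Measurable fun a : E => (Fin.cons a z : Fin (n + 1) → E) :=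
  (measurable_cons n).comp (measurable_id.prodMk measurable_const)

/-- The Efron–Stein inequality: the variance of a bounded function of independent variables is at
most the sum of its squared distances to functions that ignore one of the variables. -/
theorem efronStein (μ : Measure E) [IsProbabilityMeasure μ] {n : ℕ} {F : (Fin n → E) → ℝ}
    (hF : Measurable F) {B : ℝ} (hFB : ∀ x, |F x| ≤ B) {G : Fin n → (Fin n → E) → ℝ}
    (hG : ∀ i, Measurable (G i)) (hGB : ∀ i x, |G i x| ≤ B)
    (hGi : ∀ i x y, G i (Function.update x i y) = G i x) :
    ∫ x, F x ^ 2 ∂Measure.pi (fun _ => μ) - (∫ x, F x ∂Measure.pi (fun _ => μ)) ^ 2 ≤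
      ∑ i, ∫ x, (F x - G i x) ^ 2 ∂Measure.pi (fun _ => μ) := by
  induction n with
  | zero =>
    have h : ∀ x, F x = F default := fun x => by rw [Subsingleton.elim x default]
    simp_rw [h]
    simp
  | succ n ih =>
    have hsq : ∀ {u : (Fin (n + 1) → E) → ℝ} {B : ℝ}, (∀ x, |u x| ≤ B) → ∀ x, |u x ^ 2| ≤ B ^ 2 :=
      fun hu x => by
        rw [abs_pow]
        exact pow_le_pow_left₀ (abs_nonneg _) (hu x) 2
    have hD : ∀ i x, |F x - G i x| ≤ 2 * B := fun i x => by
      have := abs_sub (F x) (G i x)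
      linarith [hFB x, hGB i x]
    have hDm : ∀ i, Measurable fun x => F x - G i x := fun i => hF.sub (hG i)
    -- The variance splits into the mean of the conditional variance in coordinate `0` and the
    -- variance of the conditional mean `Fb`. The induction hypothesis applies to the latter.
    set Fb : (Fin n → E) → ℝ := fun z => ∫ a, F (Fin.cons a z) ∂μ with hFb
    set Gb : Fin n → (Fin n → E) → ℝ := fun i z => ∫ a, G i.succ (Fin.cons a z) ∂μ with hGb
    have hFbm : Measurable Fb := measurable_integral_cons μ n hF
    have hFbB : ∀ z, |Fb z| ≤ B := fun z => abs_integral_le_of_abs_le fun a => hFB _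
    have hGbm : ∀ i, Measurable (Gb i) := fun i => measurable_integral_cons μ n (hG _)
    have hGbB : ∀ i z, |Gb i z| ≤ B := fun i z => abs_integral_le_of_abs_le fun a => hGB _ _
    have hih := ih hFbm hFbB hGbm hGbB (fun i z y => by
      simp only [hGb, Fin.cons_update, hGi])
    have hcons := fun z : Fin n → E => measurable_cons_left (E := E) n z
    have hFsq : Integrable (fun z => ∫ a, F (Fin.cons a z) ^ 2 ∂μ)
        (Measure.pi fun _ : Fin n => μ) :=
      integrable_of_abs_le (measurable_integral_cons μ n (hF.pow_const 2))
        fun z => abs_integral_le_of_abs_le fun a => hsq hFB _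
    have hDsq : ∀ i, Integrable (fun z => ∫ a, (F (Fin.cons a z) - G i (Fin.cons a z)) ^ 2 ∂μ)
        (Measure.pi fun _ : Fin n => μ) := fun i =>
      integrable_of_abs_le (measurable_integral_cons μ n ((hDm i).pow_const 2))
        fun z => abs_integral_le_of_abs_le fun a => hsq (hD i) _
    have hFbsq : Integrable (fun z => Fb z ^ 2) (Measure.pi fun _ : Fin n => μ) :=
      integrable_sq_of_abs_le hFbm hFbB
    -- Given `z`, `G 0` is constant in `a`, and the mean is the constant nearest to `F` in mean
    -- square.
    have hzero : ∫ z, (∫ a, F (Fin.cons a z) ^ 2 ∂μ) ∂Measure.pi (fun _ : Fin n => μ) -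
        ∫ z, Fb z ^ 2 ∂Measure.pi (fun _ : Fin n => μ) ≤
        ∫ z, (∫ a, (F (Fin.cons a z) - G 0 (Fin.cons a z)) ^ 2 ∂μ)
          ∂Measure.pi (fun _ : Fin n => μ) := by
      rw [← integral_sub hFsq hFbsq]
      refine integral_mono (hFsq.sub hFbsq) (hDsq 0) fun z => ?_
      rcases isEmpty_or_nonempty E with hE | ⟨⟨a₀⟩⟩
      · simp [hFb, Measure.eq_zero_of_isEmpty μ]
      have hc : ∀ a, G 0 (Fin.cons a z) = G 0 (Fin.cons a₀ z) := fun a => by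
        rw [← hGi 0 (Fin.cons a₀ z) a, Fin.update_cons_zero]
      simp_rw [hc]
      have h := integral_sub_const_sq (μ := μ) (hF.comp (hcons z)) (fun a => hFB _)
        (G 0 (Fin.cons a₀ z))
      simp only [Function.comp_apply] at h
      rw [h]
      have := sq_nonneg (∫ a, F (Fin.cons a z) ∂μ - G 0 (Fin.cons a₀ z))
      simp only [hFb]
      linarith
    -- Jensen: averaging over coordinate `0` does not increase the squared distance.
    have hsucc : ∀ i, ∫ z, (Fb z - Gb i z) ^ 2 ∂Measure.pi (fun _ : Fin n => μ) ≤
        ∫ z, (∫ a, (F (Fin.cons a z) - G i.succ (Fin.cons a z)) ^ 2 ∂μ)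
          ∂Measure.pi (fun _ : Fin n => μ) := by
      intro i
      refine integral_mono (integrable_sq_of_abs_le (hFbm.sub (hGbm i)) (B := 2 * B) fun z => ?_)
        (hDsq i.succ) fun z => ?_
      · have := abs_sub (Fb z) (Gb i z)
        linarith [hFbB z, hGbB i z]
      · have h1 : Integrable (fun a => F (Fin.cons a z)) μ :=
          integrable_of_abs_le (hF.comp (hcons z)) fun a => hFB _
        have h2 : Integrable (fun a => G i.succ (Fin.cons a z)) μ :=
          integrable_of_abs_le ((hG _).comp (hcons z)) fun a => hGB _ _
        simp only [hFb, hGb]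
        rw [← integral_sub h1 h2]
        exact sq_integral_le_integral_sq ((hDm i.succ).comp (hcons z)) fun a => hD _ _
    rw [Fin.sum_univ_succ, integral_pi_succ μ n hF hFB, integral_pi_succ μ n (hF.pow_const 2)
      (hsq hFB), integral_pi_succ μ n ((hDm 0).pow_const 2) (hsq (hD 0))]
    simp_rw [fun i : Fin n => integral_pi_succ μ n ((hDm i.succ).pow_const 2) (hsq (hD i.succ))]
    have := Finset.sum_le_sum fun i (_ : i ∈ Finset.univ) => hsucc i
    linarith

/-- A fourth moment bound for functions that rarely change much when a variable is ignored. -/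
theorem fourth_moment_le (μ : Measure E) [IsProbabilityMeasure μ] {n : ℕ} {F : (Fin n → E) → ℝ}
    (hF : Measurable F) {B L δ : ℝ} (hFB : ∀ x, |F x| ≤ B)
    {G : Fin n → (Fin n → E) → ℝ}
    (hG : ∀ i, Measurable (G i)) (hGB : ∀ i x, |G i x| ≤ B)
    (hGi : ∀ i x y, G i (Function.update x i y) = G i x)
    (hbad : ∀ i, (Measure.pi fun _ : Fin n => μ).real {x | L < |F x - G i x|} ≤ δ)
    {v : ℝ} (hv : v = n * (L ^ 2 + 4 * B ^ 2 * δ)) :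
    ∫ x, (F x - ∫ y, F y ∂Measure.pi (fun _ => μ)) ^ 4 ∂Measure.pi (fun _ => μ) ≤
      v ^ 2 + n * (8 * L ^ 2 * v + 2 * L ^ 4 + 16 * B ^ 4 * δ) := by
  set π := Measure.pi fun _ : Fin n => μ with hπ
  set m := ∫ y, F y ∂π with hm
  have hmB : |m| ≤ B := abs_integral_le_of_abs_le hFB
  have hD : ∀ i x, |F x - G i x| ≤ 2 * B := fun i x => by
    have := abs_sub (F x) (G i x)
    linarith [hFB x, hGB i x]
  have hW : ∀ x, |F x - m| ≤ 2 * B := fun x => by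
    have := abs_sub (F x) m
    linarith [hFB x]
  have hV : ∀ i x, |G i x - m| ≤ 2 * B := fun i x => by
    have := abs_sub (G i x) m
    linarith [hGB i x]
  have hWm : Measurable fun x => F x - m := hF.sub_const m
  have hVm : ∀ i, Measurable fun x => G i x - m := fun i => (hG i).sub_const m
  have hsq : ∀ {r : ℝ}, |r| ≤ 2 * B → r ^ 2 ≤ 4 * B ^ 2 := fun {r} hr => by
    have := pow_le_pow_left₀ (abs_nonneg r) hr 2
    rw [sq_abs] at this
    linarith
  have hbadm : ∀ i, MeasurableSet {x | L < |F x - G i x|} := fun i =>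
    measurableSet_lt measurable_const ((hF.sub (hG i)).abs)
  have hind : ∀ i (c : ℝ), Integrable ({x | L < |F x - G i x|}.indicator fun _ => c) π :=
    fun i c => (integrable_const c).indicator (hbadm i)
  have hindle : ∀ i (c : ℝ), 0 ≤ c →
      ∫ x, {x | L < |F x - G i x|}.indicator (fun _ => c) x ∂π ≤ c * δ := by
    intro i c hc
    rw [integral_indicator (hbadm i), setIntegral_const, smul_eq_mul, mul_comm]
    exact mul_le_mul_of_nonneg_left (hbad i) hc
  have hWsq : Integrable (fun x => (F x - m) ^ 2) π := integrable_sq_of_abs_le hWm hW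
  have hvar : ∫ x, (F x - m) ^ 2 ∂π ≤ v := by
    rw [integral_sub_const_sq hF hFB, sub_self]
    have h5 : ∀ i, ∫ x, (F x - G i x) ^ 2 ∂π ≤ L ^ 2 + 4 * B ^ 2 * δ := by
      intro i
      calc ∫ x, (F x - G i x) ^ 2 ∂π
          ≤ ∫ x, (L ^ 2 + {x | L < |F x - G i x|}.indicator (fun _ => 4 * B ^ 2) x) ∂π := by
            refine integral_mono (integrable_sq_of_abs_le (hF.sub (hG i)) (hD i))
              ((integrable_const _).add (hind i _)) fun x => ?_
            by_cases hx : L < |F x - G i x|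
            · rw [Set.indicator_of_mem (by exact hx)]
              nlinarith [hsq (hD i x), sq_nonneg L]
            · rw [Set.indicator_of_notMem (by exact hx), add_zero]
              exact sq_le_sq' (by linarith [(abs_le.1 (not_lt.1 hx)).1])
                (abs_le.1 (not_lt.1 hx)).2
        _ ≤ L ^ 2 + 4 * B ^ 2 * δ := by
            rw [integral_add (integrable_const _) (hind i _)]
            have := hindle i (4 * B ^ 2) (by positivity)
            simpa using this
    have h6 := efronStein μ hF hFB hG hGB hGi
    have h7 := Finset.sum_le_sum fun i (_ : i ∈ Finset.univ) => h5 i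
    rw [Finset.sum_const, Finset.card_univ, Fintype.card_fin, nsmul_eq_mul, ← hv] at h7
    linarith
  have hW4 : ∀ x, |(F x - m) ^ 2| ≤ 4 * B ^ 2 := fun x => by
    rw [abs_of_nonneg (sq_nonneg _)]
    exact hsq (hW x)
  have hV4 : ∀ i x, |(G i x - m) ^ 2| ≤ 4 * B ^ 2 := fun i x => by
    rw [abs_of_nonneg (sq_nonneg _)]
    exact hsq (hV i x)
  -- The second use of Efron–Stein is for `(F - m) ^ 2`. The square of its mean is at most `v ^ 2`
  -- by the first use.
  have h2 := efronStein μ (hWm.pow_const 2) hW4 (fun i => (hVm i).pow_const 2) hV4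
    (fun i x y => by simp only [hGi])
  have h3 : ∀ i, ∫ x, ((F x - m) ^ 2 - (G i x - m) ^ 2) ^ 2 ∂π ≤
      8 * L ^ 2 * v + 2 * L ^ 4 + 16 * B ^ 4 * δ := by
    intro i
    calc ∫ x, ((F x - m) ^ 2 - (G i x - m) ^ 2) ^ 2 ∂π
        ≤ ∫ x, (8 * L ^ 2 * (F x - m) ^ 2 + 2 * L ^ 4 +
            {x | L < |F x - G i x|}.indicator (fun _ => 16 * B ^ 4) x) ∂π := by
          refine integral_mono (integrable_sq_of_abs_le
            ((hWm.pow_const 2).sub ((hVm i).pow_const 2)) (B := 8 * B ^ 2) fun x => ?_)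
            (((hWsq.const_mul _).add (integrable_const _)).add (hind i _)) fun x => ?_
          · have := abs_sub ((F x - m) ^ 2) ((G i x - m) ^ 2)
            linarith [hW4 x, hV4 i x]
          · by_cases hx : L < |F x - G i x|
            · rw [Set.indicator_of_mem (by exact hx)]
              have h1 := hsq (hW x)
              have h2 := hsq (hV i x)
              have h3 : ((F x - m) ^ 2 - (G i x - m) ^ 2) ^ 2 ≤ (4 * B ^ 2) ^ 2 := by
                refine sq_le_sq' ?_ ?_ <;> nlinarith [sq_nonneg (F x - m), sq_nonneg (G i x - m)]
              have h4 : 0 ≤ 8 * L ^ 2 * (F x - m) ^ 2 + 2 * L ^ 4 := by positivity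
              dsimp only
              linarith
            · rw [Set.indicator_of_notMem (by exact hx), add_zero]
              have hL2 : (F x - G i x) ^ 2 ≤ L ^ 2 :=
                sq_le_sq' (by linarith [(abs_le.1 (not_lt.1 hx)).1]) (abs_le.1 (not_lt.1 hx)).2
              set D := F x - G i x with hDdef
              set W := F x - m with hWdef
              -- Factoring the difference of squares leaves only `D` and `W`. With `|D| ≤ L`, the
              -- integral of the bound involves just the variance.
              have e : (W ^ 2 - (G i x - m) ^ 2) ^ 2 = D ^ 2 * (2 * W - D) ^ 2 := by
                rw [show G i x - m = W - D by rw [hDdef, hWdef]; ring]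
                ring
              have h5 : (2 * W - D) ^ 2 ≤ 8 * W ^ 2 + 2 * L ^ 2 := by
                nlinarith [sq_nonneg (2 * W + D)]
              have h6 := mul_le_mul hL2 h5 (sq_nonneg _) (sq_nonneg _)
              rw [e]
              linarith
      _ ≤ 8 * L ^ 2 * v + 2 * L ^ 4 + 16 * B ^ 4 * δ := by
          have h3 : Integrable (fun x => 8 * L ^ 2 * (F x - m) ^ 2 + 2 * L ^ 4) π :=
            (hWsq.const_mul _).add (integrable_const _)
          rw [integral_add h3 (hind i _), integral_add (hWsq.const_mul _) (integrable_const _), integral_const_mul]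
          have h4 := hindle i (16 * B ^ 4) (by positivity)
          have h5 := mul_le_mul_of_nonneg_left hvar (by positivity : 0 ≤ 8 * L ^ 2)
          simp only [integral_const, probReal_univ, one_smul]
          linarith
  have h4 := Finset.sum_le_sum fun i (_ : i ∈ Finset.univ) => h3 i
  rw [Finset.sum_const, Finset.card_univ, Fintype.card_fin, nsmul_eq_mul] at h4
  have h5 : (∫ x, (F x - m) ^ 2 ∂π) ^ 2 ≤ v ^ 2 :=
    pow_le_pow_left₀ (integral_nonneg fun _ => sq_nonneg _) hvar 2
  have e : ∀ x, (F x - m) ^ 4 = ((F x - m) ^ 2) ^ 2 := fun x => by ring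
  simp_rw [e]
  linarith

end EfronStein

/-- Random variables with summable fourth moments tend to zero almost surely. -/
theorem ae_tendsto_zero_of_summable_fourth_moment {Ω : Type*} [MeasurableSpace Ω] {μ : Measure Ω}
    {W : ℕ → Ω → ℝ} (hW : ∀ n, Measurable (W n)) {u : ℕ → ℝ} (hu : Summable u)
    (hint : ∀ᶠ n in atTop, Integrable (fun ω => W n ω ^ 4) μ)
    (hle : ∀ᶠ n in atTop, ∫ ω, W n ω ^ 4 ∂μ ≤ u n) :
    ∀ᵐ ω ∂μ, Tendsto (fun n => W n ω) atTop (𝓝 0) := by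
  obtain ⟨N, hN⟩ := eventually_atTop.1 (hint.and hle)
  have hm : ∀ n, Measurable fun ω => ENNReal.ofReal (W (n + N) ω ^ 4) := fun n =>
    ((hW _).pow_const 4).ennreal_ofReal
  have h1 : ∫⁻ ω, ∑' n, ENNReal.ofReal (W (n + N) ω ^ 4) ∂μ ≠ ∞ := by
    rw [lintegral_tsum fun n => (hm n).aemeasurable]
    have hs := ((summable_nat_add_iff N).2 hu).tsum_ofReal_lt_top
    refine (lt_of_le_of_lt (ENNReal.tsum_le_tsum fun n => ?_) hs).ne
    obtain ⟨hi, hl⟩ := hN (n + N) (Nat.le_add_left _ _)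
    rw [← ofReal_integral_eq_lintegral_ofReal hi (ae_of_all _ fun ω => by positivity)]
    exact ENNReal.ofReal_le_ofReal hl
  filter_upwards [ae_lt_top (Measurable.tsum hm) h1] with ω hω
  have h2 := ENNReal.tendsto_atTop_zero_of_tsum_ne_top hω.ne
  have h3 := (ENNReal.tendsto_toReal ENNReal.zero_ne_top).comp h2
  have h4 : Tendsto (fun n => W (n + N) ω ^ 4) atTop (𝓝 0) := by
    refine h3.congr fun n => ?_
    simp only [Function.comp_apply]
    rw [ENNReal.toReal_ofReal (by positivity)]
  rw [← tendsto_add_atTop_iff_nat N]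
  -- Two square roots of a fourth power give the absolute value.
  have h5 := (h4.sqrt).sqrt
  simp only [Real.sqrt_zero] at h5
  refine tendsto_zero_iff_abs_tendsto_zero _ |>.2 (h5.congr fun n => ?_)
  rw [Function.comp_apply, show W (n + N) ω ^ 4 = (W (n + N) ω ^ 2) ^ 2 by ring,
    Real.sqrt_sq (sq_nonneg _), Real.sqrt_sq_eq_abs]

/-! ### The binomial process: its mean and its concentration. -/

theorem binomialProcess_eq {Ω : Type*} {X : ℕ → Ω → Point d} (n : ℕ) (ω : Ω) :
    binomialProcess X n ω = Finset.univ.image fun i : Fin n => X i ω := by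
  ext y
  simp only [binomialProcess, Finset.mem_image, Finset.mem_range, Finset.mem_univ, true_and]
  exact ⟨fun ⟨i, hi, h⟩ => ⟨⟨i, hi⟩, h⟩, fun ⟨i, h⟩ => ⟨i, i.2, h⟩⟩

/-- Leaving out the `i`-th of the first `n` points and permuting the others gives the binomial
process with `n - 1` points. -/
theorem image_swap_erase {Ω : Type*} {X : ℕ → Ω → Point d} {n : ℕ} (hn : 1 ≤ n) (i : Fin n) (ω : Ω) :
    ((Finset.univ.erase i).image fun j => X (Equiv.swap i ⟨n - 1, by omega⟩ j : Fin n) ω) =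
      binomialProcess X (n - 1) ω := by
  set l : Fin n := ⟨n - 1, by omega⟩ with hl
  ext y
  simp only [binomialProcess, Finset.mem_image, Finset.mem_erase, Finset.mem_univ, and_true,
    Finset.mem_range]
  constructor
  · rintro ⟨j, hj, rfl⟩
    refine ⟨_, ?_, rfl⟩
    have h : Equiv.swap i l j ≠ l := fun h => hj
      ((Equiv.swap i l).injective (h.trans (Equiv.swap_apply_left i l).symm))
    have h2 := Fin.val_ne_of_ne h
    simp only [hl] at h2 ⊢
    omega
  · rintro ⟨k, hk, rfl⟩
    refine ⟨Equiv.swap i l ⟨k, by omega⟩, fun h => ?_, by rw [Equiv.swap_apply_self]⟩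
    have h' : (⟨k, by omega⟩ : Fin n) = l :=
      (Equiv.swap i l).injective (h.trans (Equiv.swap_apply_right i l).symm)
    have := congrArg Fin.val h'
    simp only [hl] at this
    omega

theorem image_swap {Ω : Type*} {X : ℕ → Ω → Point d} (n : ℕ) (σ : Equiv.Perm (Fin n)) (ω : Ω) :
    (Finset.univ.image fun j => X (σ j) ω) = binomialProcess X n ω := by
  rw [binomialProcess_eq]
  ext y
  simp only [Finset.mem_image, Finset.mem_univ, true_and]
  exact ⟨fun ⟨j, h⟩ => ⟨σ j, h⟩, fun ⟨j, h⟩ => ⟨σ.symm j, by rw [Equiv.apply_symm_apply, h]⟩⟩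

section Binomial

variable {Ω : Type*} [MeasurableSpace Ω] {μ : Measure Ω} [IsProbabilityMeasure μ]
  {X : ℕ → Ω → Point d} {f : Point d → ℝ}

/-- For a permuted index map `g` this is exchangeability, which transfers the difference bound from
removing the last point to removing any point. -/
theorem map_sample (hX : ∀ i, Measurable (X i)) (hindep : iIndepFun X μ)
    (hlaw : ∀ i, μ.map (X i) = densityMeasure f) {n : ℕ} {g : Fin n → ℕ}
    (hg : Function.Injective g) :
    μ.map (fun ω i => X (g i) ω) = Measure.pi fun _ => densityMeasure f := by
  have h := (iIndepFun_iff_map_fun_eq_pi_map (fun i => (hX (g i)).aemeasurable)).1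
    (hindep.precomp hg)
  rw [h]
  simp_rw [hlaw]

theorem measurable_binomialProcess (hX : ∀ i, Measurable (X i)) {G : Finset (Point d) → ℝ}
    (hG : BorelInPoints G) (n : ℕ) : Measurable fun ω => G (binomialProcess X n ω) :=
  hG.measurable_image _ hX

theorem measurable_sample (hX : ∀ i, Measurable (X i)) {n : ℕ} (g : Fin n → ℕ) :
    Measurable fun ω i => X (g i) ω := measurable_pi_lambda _ fun _ => hX _

theorem integral_binomialProcess (hX : ∀ i, Measurable (X i)) (hindep : iIndepFun X μ)
    (hlaw : ∀ i, μ.map (X i) = densityMeasure f) {G : Finset (Point d) → ℝ}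
    (hG : BorelInPoints G) (n : ℕ) : ∫ ω, G (binomialProcess X n ω) ∂μ =
      ∫ x : Fin n → Point d, G (Finset.univ.image x) ∂Measure.pi fun _ => densityMeasure f := by
  rw [← map_sample hX hindep hlaw Fin.val_injective,
    integral_map (measurable_sample hX _).aemeasurable (hG n).aestronglyMeasurable]
  simp_rw [binomialProcess_eq]

/-- The mean of the functional is asymptotically the same for the binomial and the Poisson
process. -/
theorem tendsto_poissonMean_sub_mean {H : Functional d} (hmeas : IsMeasurable H)
    (hf : IsDensity f) (hX : ∀ i, Measurable (X i)) (hindep : iIndepFun X μ)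
    (hlaw : ∀ i, μ.map (X i) = densityMeasure f) (hpoly : PolynomiallyBounded μ X H)
    (hdiff : BoundedDifference μ X H) :
    Tendsto (fun n : ℕ => 1 / (n : ℝ) * (poissonMean (H n) n f -
      ∫ ω, H n (binomialProcess X n ω) ∂μ)) atTop (𝓝 0) := by
  obtain ⟨C, q, hC, hq, hpoly⟩ := hpoly
  obtain ⟨A, a, C', b, ha, hC', hb, hA⟩ := hdiff
  have hbor : ∀ n : ℕ, 1 ≤ n → BorelInPoints (H n) := fun n hn =>
    hmeas n (by exact_mod_cast hn)
  have hm : ∀ n k : ℕ, 1 ≤ n → Measurable fun ω => H n (binomialProcess X k ω) :=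
    fun n k hn => measurable_binomialProcess hX (hbor n hn) k
  have hint : ∀ n k : ℕ, 1 ≤ n → Integrable (fun ω => H n (binomialProcess X k ω)) μ :=
    fun n k hn => Integrable.of_bound (hm n k hn).aestronglyMeasurable _ (hpoly n k hn)
  refine tendsto_poisson_average_sub_diagonal (h := fun n k => ∫ ω, H n (binomialProcess X k ω) ∂μ)
    (S := fun n => poissonMean (H n) n f) hC hq hC' (by linarith : b < 1 / 2) ha ?_ ?_ ?_
  · intro n k hn
    simpa using norm_integral_le_of_norm_le_const
      (f := fun ω => H n (binomialProcess X k ω)) (hpoly n k hn)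
  -- The range `0 < k < 2 * n` is exactly `|k - n| < n`, which is where the bounded difference
  -- condition applies.
  · intro n k hn hk hkn
    obtain ⟨hAm, hAle, hAd⟩ := hA n hn
    have hn0 : (0 : ℝ) < n := by exact_mod_cast hn
    have hkn' : (k : ℝ) ≤ 2 * n := by exact_mod_cast hkn.le
    have hreal : μ.real (A n)ᶜ ≤ Real.exp (-(n : ℝ) ^ a) :=
      ENNReal.toReal_le_of_le_ofReal (Real.exp_pos _).le hAle
    have hpt : ∀ᵐ ω ∂μ, ‖H n (binomialProcess X k ω) - H n (binomialProcess X n ω)‖ ≤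
        C' * |(k : ℝ) - n| * (n : ℝ) ^ b +
          (A n)ᶜ.indicator (fun _ => 2 * C * (2 * n : ℝ) ^ q) ω := by
      filter_upwards [hAd, hpoly n k hn, hpoly n n hn] with ω h1 h2 h3
      rw [Real.norm_eq_abs]
      by_cases hω : ω ∈ A n
      · rw [Set.indicator_of_notMem (by simpa using hω), add_zero, abs_sub_comm]
        rcases le_total n k with hle | hle
        · have h4 := (h1 hω (k - n) (by omega)).1
          rw [Nat.add_sub_cancel' hle, Nat.cast_sub hle] at h4
          rwa [abs_of_nonneg (a := (k : ℝ) - n) (sub_nonneg.2 (by exact_mod_cast hle))]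
        · have h4 := (h1 hω (n - k) (by omega)).2
          rw [Nat.sub_sub_self hle, Nat.cast_sub hle] at h4
          rwa [abs_sub_comm (k : ℝ),
            abs_of_nonneg (a := (n : ℝ) - k) (sub_nonneg.2 (by exact_mod_cast hle))]
      · rw [Set.indicator_of_mem (by simpa using hω)]
        have h4 : (max n k : ℝ) ^ q ≤ (2 * n : ℝ) ^ q :=
          Real.rpow_le_rpow (by positivity) (max_le (by linarith) hkn') hq.le
        have h5 : (max n n : ℝ) ^ q ≤ (2 * n : ℝ) ^ q :=
          Real.rpow_le_rpow (by positivity) (max_le (by linarith) (by linarith)) hq.le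
        have h6 := mul_le_mul_of_nonneg_left h4 hC.le
        have h7 := mul_le_mul_of_nonneg_left h5 hC.le
        have h8 := abs_sub (H n (binomialProcess X k ω)) (H n (binomialProcess X n ω))
        have h9 : 0 ≤ C' * |(k : ℝ) - n| * (n : ℝ) ^ b := by positivity
        linarith
    rw [← integral_sub (hint n k hn) (hint n n hn)]
    have hi : Integrable ((A n)ᶜ.indicator fun _ : Ω => 2 * C * (2 * n : ℝ) ^ q) μ :=
      (integrable_const _).indicator hAm.compl
    refine (norm_integral_le_of_norm_le ((integrable_const _).add hi) hpt).trans ?_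
    simp only [Pi.add_apply]
    rw [integral_add (integrable_const _) hi, integral_indicator hAm.compl, setIntegral_const]
    simp only [integral_const, probReal_univ, smul_eq_mul]
    have := mul_le_mul_of_nonneg_left hreal (by positivity : 0 ≤ 2 * C * (2 * n : ℝ) ^ q)
    linarith
  · intro n hn
    have hn0 : (0 : ℝ) < n := by exact_mod_cast hn
    simp_rw [integral_binomialProcess hX hindep hlaw (hbor n hn)]
    refine hasSum_poissonMean (hbor n hn) hn0.le hf (B := fun k => C * (max n k : ℝ) ^ q)
      (fun k => ?_) ?_
    · rw [← map_sample hX hindep hlaw Fin.val_injective,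
        ae_map_iff (measurable_sample hX _).aemeasurable
          (measurableSet_le (hbor n hn k).abs measurable_const)]
      simpa only [binomialProcess_eq] using hpoly n k hn
    · obtain ⟨K, hK, hKle⟩ := exists_rpow_le_pow q (r := 2) (by norm_num)
      refine Summable.of_nonneg_of_le
        (fun k => mul_nonneg (poissonWeight_nonneg hn0.le k) (by positivity)) (fun k => ?_)
        (((hasSum_poissonWeight (n : ℝ)).summable.mul_left (C * (n : ℝ) ^ q)).add
          ((hasSum_poissonWeight_mul_pow n 2).summable.mul_left (C * K)))
      have h1 : (max n k : ℝ) ^ q ≤ (n : ℝ) ^ q + K * 2 ^ k := by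
        have h2 : 0 ≤ (n : ℝ) ^ q := by positivity
        have h3 : 0 ≤ K * 2 ^ k := by positivity
        rcases le_total (n : ℝ) k with h | h
        · rw [max_eq_right h]
          linarith [hKle k]
        · rw [max_eq_left h]
          linarith
      calc poissonWeight n k * (C * (max n k : ℝ) ^ q)
          ≤ poissonWeight n k * (C * ((n : ℝ) ^ q + K * 2 ^ k)) :=
            mul_le_mul_of_nonneg_left (mul_le_mul_of_nonneg_left h1 hC.le)
              (poissonWeight_nonneg hn0.le k)
        _ = _ := by ring

/-- Truncation of a real number at the levels `±B`. -/
def truncate (B r : ℝ) : ℝ := max (-B) (min r B)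

theorem measurable_truncate (B : ℝ) : Measurable (truncate B) :=
  measurable_const.max (measurable_id.min measurable_const)

theorem abs_truncate_le {B : ℝ} (hB : 0 ≤ B) (r : ℝ) : |truncate B r| ≤ B :=
  abs_le.2 ⟨le_max_left _ _, max_le (by linarith) (min_le_right _ _)⟩

theorem truncate_eq_self {B r : ℝ} (h : |r| ≤ B) : truncate B r = r := by
  rw [truncate, min_eq_left (abs_le.1 h).2, max_eq_right (abs_le.1 h).1]

theorem abs_truncate_sub_le (B r s : ℝ) : |truncate B r - truncate B s| ≤ |r - s| := by
  unfold truncate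
  refine (abs_max_sub_max_le_max _ _ _ _).trans ?_
  rw [sub_self, abs_zero, max_eq_right (abs_nonneg _)]
  refine (abs_min_sub_min_le_max _ _ _ _).trans ?_
  rw [sub_self, abs_zero, max_eq_left (abs_nonneg _)]

/-- The fourth central moment of the functional of the binomial process. -/
theorem fourth_moment_binomialProcess_le (hf : IsDensity f) (hX : ∀ i, Measurable (X i))
    (hindep : iIndepFun X μ) (hlaw : ∀ i, μ.map (X i) = densityMeasure f)
    {G : Finset (Point d) → ℝ} (hG : BorelInPoints G) {n : ℕ} (hn : 1 ≤ n) {B L δ : ℝ}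
    (hB : 0 ≤ B) (hGB : ∀ᵐ ω ∂μ, |G (binomialProcess X n ω)| ≤ B)
    {A : Set Ω} (hδ : μ.real Aᶜ ≤ δ)
    (hGA : ∀ᵐ ω ∂μ, ω ∈ A →
      |G (binomialProcess X n ω) - G (binomialProcess X (n - 1) ω)| ≤ L)
    {v : ℝ} (hv : v = n * (L ^ 2 + 4 * B ^ 2 * δ)) :
    ∫ ω, (G (binomialProcess X n ω) - ∫ ω', G (binomialProcess X n ω') ∂μ) ^ 4 ∂μ ≤
      v ^ 2 + n * (8 * L ^ 2 * v + 2 * L ^ 4 + 16 * B ^ 4 * δ) := by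
  have := hf.isProbabilityMeasure
  -- The polynomial bound holds only almost surely, while `fourth_moment_le` requires `F` and every
  -- `G i` to be bounded everywhere. Truncation at `B` provides this, leaves the functional
  -- unchanged almost surely, and does not increase differences.
  have hT : BorelInPoints fun S => truncate B (G S) := fun k => (measurable_truncate B).comp (hG k)
  have hTe : ∀ᵐ ω ∂μ, G (binomialProcess X n ω) = truncate B (G (binomialProcess X n ω)) := by
    filter_upwards [hGB] with ω hω using (truncate_eq_self hω).symm
  have hFm : Measurable fun x : Fin n → Point d => truncate B (G (Finset.univ.image x)) := hT n
  have hGm : ∀ i, Measurable fun x : Fin n → Point d =>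
      truncate B (G ((Finset.univ.erase i).image x)) := fun i =>
    hT.measurable_image (α := Fin n → Point d) _ (p := fun j x => x j)
      fun j => measurable_pi_apply j
  have h := fourth_moment_le (densityMeasure f) (n := n)
    (F := fun x => truncate B (G (Finset.univ.image x))) hFm
    (fun x => abs_truncate_le hB _)
    (G := fun i x => truncate B (G ((Finset.univ.erase i).image x))) hGm
    (fun i x => abs_truncate_le hB _) ?_ (δ := δ) ?_ hv
  · rw [← integral_binomialProcess hX hindep hlaw hT] at h
    have e := integral_binomialProcess hX hindep hlaw (G := fun S =>
      (truncate B (G S) - ∫ ω, truncate B (G (binomialProcess X n ω)) ∂μ) ^ 4)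
      (fun k => ((hT k).sub_const _).pow_const 4) n
    rw [← e, ← integral_congr_ae hTe] at h
    refine le_trans (le_of_eq (integral_congr_ae ?_)) h
    filter_upwards [hTe] with ω hω
    rw [← hω]
  · intro i x y
    congr 2
    refine Finset.image_congr fun j hj => ?_
    rw [Function.update_of_ne (Finset.ne_of_mem_erase (Finset.mem_coe.1 hj))]
  · intro i
    refine le_trans ?_ hδ
    -- Swapping `i` with the last index preserves the law of the sample and turns the removal of
    -- point `i` into the passage from `n` to `n - 1` points.
    set σ := Equiv.swap i (⟨n - 1, by omega⟩ : Fin n) with hσ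
    have hinj : Function.Injective fun j => ((σ j : Fin n) : ℕ) :=
      Fin.val_injective.comp σ.injective
    have hset : MeasurableSet {x : Fin n → Point d | L <
        |truncate B (G (Finset.univ.image x)) -
          truncate B (G ((Finset.univ.erase i).image x))|} :=
      measurableSet_lt measurable_const (hFm.sub (hGm i)).abs
    rw [← map_sample hX hindep hlaw hinj, measureReal_def, measureReal_def,
      Measure.map_apply (measurable_sample hX _) hset]
    refine ENNReal.toReal_mono (measure_ne_top _ _) (measure_mono_ae ?_)
    filter_upwards [hGA] with ω hω hbad hA
    have hbad' : L < |truncate B (G (Finset.univ.image fun j => X (σ j) ω)) -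
        truncate B (G ((Finset.univ.erase i).image fun j => X (σ j) ω))| := hbad
    rw [image_swap, image_swap_erase hn] at hbad'
    exact absurd ((abs_truncate_sub_le _ _ _).trans (hω hA)) (not_le.2 hbad')

/-- The functional of the binomial process concentrates around its mean. -/
theorem ae_tendsto_sub_mean {H : Functional d} (hmeas : IsMeasurable H)
    (hf : IsDensity f) (hX : ∀ i, Measurable (X i)) (hindep : iIndepFun X μ)
    (hlaw : ∀ i, μ.map (X i) = densityMeasure f) (hpoly : PolynomiallyBounded μ X H)
    (hdiff : BoundedDifference μ X H) :
    ∀ᵐ ω ∂μ, Tendsto (fun n : ℕ => 1 / (n : ℝ) * (H n (binomialProcess X n ω) -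
      ∫ ω', H n (binomialProcess X n ω') ∂μ)) atTop (𝓝 0) := by
  obtain ⟨C, q, hC, hq, hpoly⟩ := hpoly
  obtain ⟨A, a, K, b, ha, hK, hb, hA⟩ := hdiff
  have hbor : ∀ n : ℕ, 1 ≤ n → BorelInPoints (H n) := fun n hn =>
    hmeas n (by exact_mod_cast hn)
  -- The exponent is made nonnegative so that `L = K * n ^ b'` is at least `K`. The exceptional
  -- terms, eventually below powers of `K`, are then absorbed by powers of `L`.
  set b' := max b 0 with hb'
  have hb'0 : 0 ≤ b' := le_max_right _ _
  have hb'1 : b' < 1 / 4 := max_lt hb (by norm_num)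
  -- This is where `b < 1/4` is decisive: it gives `4 * b' - 2 < -1`.
  have hsumm : Summable fun n : ℕ => 23 * K ^ 4 * (n : ℝ) ^ (4 * b' - 2) :=
    (Real.summable_nat_rpow.2 (by linarith)).mul_left _
  -- The value at `n = 0` is replaced by `0` because measurability of `H η` is assumed only for `η >
  -- 0`.
  have hW : ∀ n : ℕ, Measurable fun ω => if 1 ≤ n then 1 / (n : ℝ) * (H n (binomialProcess X n ω) -
      ∫ ω', H n (binomialProcess X n ω') ∂μ) else 0 := by
    intro n
    split_ifs with hn
    · exact ((measurable_binomialProcess hX (hbor n hn) n).sub_const _).const_mul _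
    · exact measurable_const
  have hbound : ∀ n : ℕ, 1 ≤ n → ∀ᵐ ω ∂μ, |H n (binomialProcess X n ω)| ≤ C * (n : ℝ) ^ q := by
    intro n hn
    simpa using hpoly n n hn
  have e1 : ∀ᶠ n : ℕ in atTop, 4 * C ^ 2 * ((n : ℝ) ^ (2 * q) * Real.exp (-(n : ℝ) ^ a)) ≤ K ^ 2 :=
    by
    have h := (tendsto_rpow_mul_exp_neg_rpow (2 * q) ha).const_mul (4 * C ^ 2)
    rw [mul_zero] at h
    exact h.eventually_le_const (by positivity)
  have e2 : ∀ᶠ n : ℕ in atTop, 16 * C ^ 4 * ((n : ℝ) ^ (4 * q) * Real.exp (-(n : ℝ) ^ a)) ≤ K ^ 4 :=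
    by
    have h := (tendsto_rpow_mul_exp_neg_rpow (4 * q) ha).const_mul (16 * C ^ 4)
    rw [mul_zero] at h
    exact h.eventually_le_const (by positivity)
  have hfin := ae_tendsto_zero_of_summable_fourth_moment (μ := μ) hW hsumm ?_ ?_
  · filter_upwards [hfin] with ω hω
    refine hω.congr' ?_
    filter_upwards [eventually_ge_atTop 1] with n hn
    rw [if_pos hn]
  · filter_upwards [eventually_ge_atTop 1] with n hn
    refine Integrable.of_bound ((hW n).pow_const 4).aestronglyMeasurable
      ((1 / (n : ℝ) * (C * (n : ℝ) ^ q + |∫ ω', H n (binomialProcess X n ω') ∂μ|)) ^ 4) ?_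
    filter_upwards [hbound n hn] with ω hω
    rw [if_pos hn, norm_pow, norm_mul, Real.norm_of_nonneg (by positivity : 0 ≤ 1 / (n : ℝ)),
      Real.norm_eq_abs]
    gcongr
    exact (abs_sub _ _).trans (by gcongr)
  -- The difference bound is used with `Δ = 1`, and `Δ < n` forces `n ≥ 2`.
  · filter_upwards [eventually_ge_atTop 2, e1, e2] with n hn2 h1 h2
    have hn : 1 ≤ n := by omega
    have hn0 : (0 : ℝ) < n := by exact_mod_cast hn
    have hn1 : (1 : ℝ) ≤ n := by exact_mod_cast hn
    obtain ⟨hAm, hAle, hAd⟩ := hA n hn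
    have hreal : μ.real (A n)ᶜ ≤ Real.exp (-(n : ℝ) ^ a) :=
      ENNReal.toReal_le_of_le_ofReal (Real.exp_pos _).le hAle
    set L := K * (n : ℝ) ^ b' with hLdef
    set B := C * (n : ℝ) ^ q with hBdef
    set δ := Real.exp (-(n : ℝ) ^ a) with hδdef
    have hKL : K ≤ L := le_mul_of_one_le_right hK.le (Real.one_le_rpow hn1 hb'0)
    have hB2 : 4 * B ^ 2 * δ ≤ L ^ 2 := by
      refine le_trans (le_of_eq ?_) (h1.trans (pow_le_pow_left₀ hK.le hKL 2))
      rw [hBdef, mul_pow, ← Real.rpow_mul_natCast hn0.le, Nat.cast_ofNat, mul_comm q 2]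
      ring
    have hB4 : 16 * B ^ 4 * δ ≤ L ^ 4 := by
      refine le_trans (le_of_eq ?_) (h2.trans (pow_le_pow_left₀ hK.le hKL 4))
      rw [hBdef, mul_pow, ← Real.rpow_mul_natCast hn0.le, Nat.cast_ofNat, mul_comm q 4]
      ring
    have hmain := fourth_moment_binomialProcess_le hf hX hindep hlaw (hbor n hn) hn (B := B)
      (L := L) (by positivity) (hbound n hn) hreal (by
        filter_upwards [hAd] with ω hω hωA
        have h3 := (hω hωA 1 (by omega)).2
        refine h3.trans ?_
        rw [Nat.cast_one, mul_one]
        exact mul_le_mul_of_nonneg_left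
          (Real.rpow_le_rpow_of_exponent_le hn1 (le_max_left _ _)) hK.le) rfl
    set v := (n : ℝ) * (L ^ 2 + 4 * B ^ 2 * δ) with hv
    have hv0 : 0 ≤ v := by positivity
    have hv1 : v ≤ 2 * n * L ^ 2 := by
      rw [hv]
      nlinarith
    have hL4 : 0 ≤ L ^ 4 := by positivity
    -- The constant is `23 = 4 + 16 + 3`: from `v ^ 2`, from `8 * L ^ 2 * v`, and from the two
    -- remaining terms, using `n ≤ n ^ 2`.
    have htot : v ^ 2 + n * (8 * L ^ 2 * v + 2 * L ^ 4 + 16 * B ^ 4 * δ) ≤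
        23 * (n : ℝ) ^ 2 * L ^ 4 := by
      have s1 : v ^ 2 ≤ (2 * n * L ^ 2) ^ 2 := pow_le_pow_left₀ hv0 hv1 2
      have s2 : 8 * L ^ 2 * v ≤ 8 * L ^ 2 * (2 * n * L ^ 2) :=
        mul_le_mul_of_nonneg_left hv1 (by positivity)
      have s3 : n * (8 * L ^ 2 * v + 2 * L ^ 4 + 16 * B ^ 4 * δ) ≤
          n * (8 * L ^ 2 * (2 * n * L ^ 2) + 2 * L ^ 4 + L ^ 4) :=
        mul_le_mul_of_nonneg_left (by linarith) hn0.le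
      have s4 : (n : ℝ) * L ^ 4 ≤ n ^ 2 * L ^ 4 :=
        mul_le_mul_of_nonneg_right (by nlinarith) hL4
      nlinarith
    simp only [if_pos hn, mul_pow]
    rw [integral_const_mul]
    calc (1 / (n : ℝ)) ^ 4 * ∫ ω, (H n (binomialProcess X n ω) -
          ∫ ω', H n (binomialProcess X n ω') ∂μ) ^ 4 ∂μ
        ≤ (1 / (n : ℝ)) ^ 4 * (23 * (n : ℝ) ^ 2 * L ^ 4) :=
          mul_le_mul_of_nonneg_left (hmain.trans htot) (by positivity)
      _ = 23 * K ^ 4 * (n : ℝ) ^ (4 * b' - 2) := by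
          rw [hLdef, mul_pow, ← Real.rpow_mul_natCast hn0.le, Real.rpow_sub hn0, mul_comm b']
          norm_num
          field_simp

end Binomial

end ScaleInvariantFunctional

/-! ### Conclusion. -/

theorem theorem4p2 {d : ℕ} (hd : 1 ≤ d)
    -- the functional and the class of densities
    (H : Functional d) (hmeas : IsMeasurable H)
    (𝒟 : Set (Point d → ℝ)) (h𝒟 : IsDensityClass 𝒟)
    -- the conditions on the Poisson process
    (Hstar : ℝ) (hpos : 0 < Hstar)
    (htrans : TranslationInvariant H)
    (hlin : LinearScale H Hstar)
    (hscale : ScaleInvariant H Hstar)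
    (hhom : Homogeneous H 𝒟)
    (hadd : AsymptoticallyAdditive H)
    (hcont : ContinuousFromBelow H 𝒟)
    -- the density and the iid sample
    (f : Point d → ℝ) (hf : f ∈ 𝒟) (hfcont : ∀ᵐ x, ContinuousAt f x)
    {Ω : Type*} [MeasurableSpace Ω] (μ : Measure Ω) [IsProbabilityMeasure μ]
    (X : ℕ → Ω → Point d) (hX : ∀ i, Measurable (X i)) (hindep : iIndepFun X μ)
    (hlaw : ∀ i, μ.map (X i) = densityMeasure f)
    -- the conditions on the binomial process
    (hpoly : PolynomiallyBounded μ X H)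
    (hdiff : BoundedDifference μ X H) :
    Tendsto (fun n : ℕ => 1 / (n : ℝ) * ∫ ω, H n (binomialProcess X n ω) ∂μ) atTop (𝓝 Hstar) ∧
      ∀ᵐ ω ∂μ, Tendsto (fun n : ℕ => 1 / (n : ℝ) * H n (binomialProcess X n ω)) atTop
        (𝓝 Hstar) := by
  have hfd := h𝒟.1 f hf
  have hmean : Tendsto (fun n : ℕ => 1 / (n : ℝ) * ∫ ω, H n (binomialProcess X n ω) ∂μ) atTop
      (𝓝 Hstar) := by
    have h1 := (tendsto_poissonMean hd hmeas h𝒟 hpos htrans hscale hhom hadd hcont hf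
      hfcont).comp tendsto_natCast_atTop_atTop
    have h2 := h1.sub (tendsto_poissonMean_sub_mean hmeas hfd hX hindep hlaw hpoly hdiff)
    rw [sub_zero] at h2
    refine h2.congr fun n => ?_
    simp only [Function.comp_apply]
    ring
  refine ⟨hmean, ?_⟩
  filter_upwards [ae_tendsto_sub_mean hmeas hfd hX hindep hlaw hpoly hdiff] with ω hω
  have h := hω.add hmean
  rw [zero_add] at h
  refine h.congr fun n => ?_
  ring
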